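/- Let $\mathcal H$ be the Hilbert space of one bosonic mode, with number basis $\{|n\rangle\}_{n\ge 0}$, annihilation operator $\hat a$ and displacement operators $\hat D(\alpha)=\exp(\alpha\hat a^\dagger-\alpha^*\hat a)$, $\alpha\in\mathbb C$. For a trace class operator $\hat\rho$ on $\mathcal H$ define: - the Gaussian loss channel with transmissivity $\eta\in[0,1]$ and $\bar n_{\rm th}\ge 0$ thermal photons, $\mathcal N[\eta,\bar n_{\rm th}](\hat\rho)=\mathrm{Tr}_2\big[\hat B(\eta)(\hat\rho\otimes\hat\rho_{\bar n_{\rm th}})\hat B(\eta)^\dagger\big]$, where $\hat\rho_{\bar n_{\rm th}}=\sum_{n\ge 0}\frac{\bar n_{\rm th}^{\,n}}{(\bar n_{\rm th}+1)^{n+1}}|n\rangle\langle n|$ and $\hat B(\eta)$ is the beam splitter unitary on two modes, which acts in the Heisenberg picture by $\hat a_1\mapsto\sqrt\eta\,\hat a_1+\sqrt{1-\eta}\,\hat a_2$, $\hat a_2\mapsto-\sqrt{1-\eta}\,\hat a_1+\sqrt\eta\,\hat a_2$; - the quantum-limited amplification channel with gain $G\ge 1$, $\mathcal A[G](\hat\rho)=\mathrm{Tr}_2\big[\hat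 S_2(G)(\hat\rho\otimes|0\rangle\langle 0|)\hat S_2(G)^\dagger\big]$, where $\hat S_2(G)$ is the two-mode squeezing unitary, which acts by $\hat a_1\mapsto\sqrt G\,\hat a_1+\sqrt{G-1}\,\hat a_2^\dagger$, $\hat a_2\mapsto\sqrt{G-1}\,\hat a_1^\dagger+\sqrt G\,\hat a_2$; - the Gaussian random displacement channel of variance $\sigma^2>0$, $\mathcal N_{B_2}[\sigma^2](\hat\rho)=\frac1{\pi\sigma^2}\int_{\mathbb C}e^{-|\alpha|^2/\sigma^2}\,\hat D(\alpha)\hat\rho\hat D(\alpha)^\dagger\,d^2\alpha$, and $\mathcal N_{B_2}[0](\hat\rho)=\hat\rho$. **Lemma.** Let $0<\eta\le 1$ and $\bar n_{\rm th}\ge 0$. Then $$\mathcal N[\eta,\bar n_{\rm th}]\circ\mathcal A[1/\eta]=\mathcal N_{B_2}[\tilde\sigma^2],\qquad \tilde\sigma^2=(1-\eta)(\bar n_{\rm th}+1),$$ as maps on the trace class operators on $\mathcal H$ (in particular, on all density operators). Moreover, if $\eta<1$, then $\tilde\sigma^2$ is strictly less than the post-amplification variance $\sigma^2=\frac{1-\eta}{\eta}(\bar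 n_{\rm th}+1)$. -/

import Mathlib

open MeasureTheory

noncomputable section

namespace Bosonic

/-- The Hilbert space `L²(ℝ)` of one bosonic mode, in the position representation: the quadratures
are `q̂ = x` and `p̂ = -i d/dx`, and `â = (q̂ + i p̂) / √2`. -/
abbrev Mode : Type := Lp ℂ 2 (volume : Measure ℝ)

/-- The Hilbert space `L²(ℝ × ℝ) = L²(ℝ) ⊗ L²(ℝ)` of two bosonic modes. -/
abbrev TwoMode : Type := Lp ℂ 2 (volume : Measure (ℝ × ℝ))

/-! ### Number states -/

/-- The wave function of the number state `|n⟩`, i.e. the normalized Hermite function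
`π^(-1/4) (n!)^(-1/2) He_n(√2 x) exp(-x²/2)`, where `He_n` is the probabilists' Hermite
polynomial; equivalently `(â†)^n |0⟩ / √(n!)` with `â† = (x - d/dx) / √2`. -/
def fockFun (n : ℕ) (x : ℝ) : ℂ :=
  ((Real.sqrt (Real.sqrt Real.pi))⁻¹ * (Real.sqrt (n.factorial : ℝ))⁻¹
    * Polynomial.aeval (Real.sqrt 2 * x) (Polynomial.hermite n) * Real.exp (-x ^ 2 / 2) : ℝ)

theorem continuous_fockFun (n : ℕ) : Continuous (fockFun n) := by
  unfold fockFun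
  apply Complex.continuous_ofReal.comp
  have h : Continuous fun x : ℝ =>
      Polynomial.aeval (Real.sqrt 2 * x) (Polynomial.hermite n) :=
    (Polynomial.continuous_aeval _).comp (continuous_const.mul continuous_id)
  fun_prop

theorem integrable_poly_mul_gaussian (p : Polynomial ℝ) :
    Integrable (fun x : ℝ => p.eval x * Real.exp (-x ^ 2)) := by
  induction p using Polynomial.induction_on' with
  | add p q hp hq =>
    refine (hp.add hq).congr (Filter.Eventually.of_forall fun x => ?_)
    simp [add_mul]
  | monomial n a =>
    have h := (integrable_rpow_mul_exp_neg_mul_sq (b := 1) one_pos (s := (n : ℝ))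
      (by have : (0 : ℝ) ≤ n := n.cast_nonneg
          linarith)).const_mul a
    refine h.congr (Filter.Eventually.of_forall fun x => ?_)
    simp [mul_assoc]

theorem memLp_fockFun (n : ℕ) : MemLp (fockFun n) 2 (volume : Measure ℝ) := by
  rw [memLp_two_iff_integrable_sq_norm (continuous_fockFun n).aestronglyMeasurable]
  set P : Polynomial ℝ := ((Polynomial.hermite n).map (Int.castRingHom ℝ)).comp
    (Polynomial.C (Real.sqrt 2) * Polynomial.X) with hP
  have h := (integrable_poly_mul_gaussian (P ^ 2)).const_mul
    (((Real.sqrt (Real.sqrt Real.pi))⁻¹ * (Real.sqrt (n.factorial : ℝ))⁻¹) ^ 2)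
  refine h.congr (Filter.Eventually.of_forall fun x => ?_)
  have e : Real.exp (-x ^ 2) = Real.exp (-x ^ 2 / 2) ^ 2 := by
    rw [← Real.exp_nat_mul]; congr 1; push_cast; ring
  have hx : Polynomial.aeval (Real.sqrt 2 * x) (Polynomial.hermite n) = P.eval x := by
    simp [hP, Polynomial.aeval_def, Polynomial.eval₂_eq_eval_map]
  simp only [fockFun, Complex.norm_real, Real.norm_eq_abs, sq_abs, hx, Polynomial.eval_pow, e]
  ring

/-- The number state `|n⟩`; the vacuum is `fock 0`. -/
def fock (n : ℕ) : Mode := (memLp_fockFun n).toLp (fockFun n)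

/-! ### Product vectors and the tensor product of operators -/

theorem memLp_mul_prod (ψ φ : Mode) :
    MemLp (fun z : ℝ × ℝ => ψ z.1 * φ z.2) 2 (volume : Measure (ℝ × ℝ)) := by
  have h1 := (Lp.aestronglyMeasurable ψ).comp_fst (ν := (volume : Measure ℝ))
  have h2 := (Lp.aestronglyMeasurable φ).comp_snd (μ := (volume : Measure ℝ))
  refine (memLp_two_iff_integrable_sq_norm (h1.mul h2)).2 ?_
  have i1 := (memLp_two_iff_integrable_sq_norm (Lp.aestronglyMeasurable ψ)).1 (Lp.memLp ψ)
  have i2 := (memLp_two_iff_integrable_sq_norm (Lp.aestronglyMeasurable φ)).1 (Lp.memLp φ)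
  simpa [mul_pow] using i1.mul_prod i2

/-- The product vector `ψ ⊗ φ`. -/
def tmul (ψ φ : Mode) : TwoMode := (memLp_mul_prod ψ φ).toLp _

theorem coeFn_tmul (ψ φ : Mode) :
    tmul ψ φ =ᵐ[volume] fun z : ℝ × ℝ => ψ z.1 * φ z.2 := MemLp.coeFn_toLp _

theorem tmul_add_left (ψ ψ' φ : Mode) : tmul (ψ + ψ') φ = tmul ψ φ + tmul ψ' φ := by
  apply Lp.ext
  have h : ∀ᵐ z : ℝ × ℝ, (ψ + ψ' : Mode) z.1 = ψ z.1 + ψ' z.1 :=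
    Measure.quasiMeasurePreserving_fst.ae (Lp.coeFn_add ψ ψ')
  filter_upwards [coeFn_tmul (ψ + ψ') φ, coeFn_tmul ψ φ, coeFn_tmul ψ' φ,
    Lp.coeFn_add (tmul ψ φ) (tmul ψ' φ), h] with z h1 h2 h3 h4 h5
  simp only [h1, h4, Pi.add_apply, h2, h3, h5, add_mul]

theorem tmul_smul_left (c : ℂ) (ψ φ : Mode) : tmul (c • ψ) φ = c • tmul ψ φ := by
  apply Lp.ext
  have h : ∀ᵐ z : ℝ × ℝ, (c • ψ : Mode) z.1 = c • ψ z.1 :=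
    Measure.quasiMeasurePreserving_fst.ae (Lp.coeFn_smul c ψ)
  filter_upwards [coeFn_tmul (c • ψ) φ, coeFn_tmul ψ φ, Lp.coeFn_smul c (tmul ψ φ), h]
    with z h1 h2 h3 h4
  simp only [h1, h3, Pi.smul_apply, h2, h4, smul_eq_mul, mul_assoc]

theorem norm_tmul (ψ φ : Mode) : ‖tmul ψ φ‖ = ‖ψ‖ * ‖φ‖ := by
  have key : ∀ {X : Type} [MeasureSpace X] (f : Lp ℂ 2 (volume : Measure X)),
      ‖f‖ ^ 2 = ∫ x, ‖f x‖ ^ 2 := by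
    intro X _ f
    have h := L2.inner_def (𝕜 := ℂ) f f
    rw [inner_self_eq_norm_sq_to_K] at h
    simp only [inner_self_eq_norm_sq_to_K] at h
    have h' : ((‖f‖ ^ 2 : ℝ) : ℂ) = ((∫ x, ‖f x‖ ^ 2 : ℝ) : ℂ) := by
      rw [← integral_complex_ofReal]; simpa using h
    exact_mod_cast h'
  have hsq : ‖tmul ψ φ‖ ^ 2 = (‖ψ‖ * ‖φ‖) ^ 2 := by
    rw [mul_pow, key, key, key, ← integral_prod_mul]
    apply integral_congr_ae
    filter_upwards [coeFn_tmul ψ φ] with z hz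
    rw [hz, norm_mul, mul_pow]
  exact (sq_eq_sq₀ (norm_nonneg _) (by positivity)).1 hsq

/-- The bounded operator `ψ ↦ ψ ⊗ φ`. Its adjoint is the partial inner product with `φ` on the
second mode. -/
def tensorRight (φ : Mode) : Mode →L[ℂ] TwoMode :=
  LinearMap.mkContinuous
    { toFun := fun ψ => tmul ψ φ
      map_add' := fun ψ ψ' => tmul_add_left ψ ψ' φ
      map_smul' := fun c ψ => tmul_smul_left c ψ φ }
    ‖φ‖ (fun ψ => by
      change ‖tmul ψ φ‖ ≤ _
      rw [norm_tmul, mul_comm])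

open Classical in
/-- The tensor product `A ⊗ B` of bounded operators: the (unique) bounded operator with
`(A ⊗ B)(ψ ⊗ φ) = Aψ ⊗ Bφ`. -/
def opTensor (A B : Mode →L[ℂ] Mode) : TwoMode →L[ℂ] TwoMode :=
  if h : ∃ T : TwoMode →L[ℂ] TwoMode, ∀ ψ φ, T (tmul ψ φ) = tmul (A ψ) (B φ) then h.choose else 0

/-! ### Traces and states -/

/-- The index set of `modeBasis`. -/
def modeIndex : Set Mode := (exists_hilbertBasis ℂ Mode).choose

/-- A fixed orthonormal basis of the one-mode space, used to write down traces; traces of trace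
class operators do not depend on it. -/
def modeBasis : HilbertBasis modeIndex ℂ Mode := (exists_hilbertBasis ℂ Mode).choose_spec.choose

/-- Density operators: positive operators of trace one. -/
def IsDensityOperator (ρ : Mode →L[ℂ] Mode) : Prop :=
  ρ.IsPositive ∧ HasSum (fun i => inner ℂ (modeBasis i) (ρ (modeBasis i))) 1

/-- Trace class operators: the linear span of the density operators. -/
def traceClass : Submodule ℂ (Mode →L[ℂ] Mode) := Submodule.span ℂ {ρ | IsDensityOperator ρ}

/-- The partial trace `Tr₂ T = ∑ᵢ ⟨eᵢ|T|eᵢ⟩` over the second mode; the series converges absolutely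
in operator norm when `T` is trace class. -/
def partialTrace (T : TwoMode →L[ℂ] TwoMode) : Mode →L[ℂ] Mode :=
  ∑' i, (tensorRight (modeBasis i)).adjoint ∘L T ∘L tensorRight (modeBasis i)

/-- The thermal state `∑ₙ n̄ⁿ / (n̄ + 1)ⁿ⁺¹ |n⟩⟨n|` with average photon number `n̄`. -/
def thermalState (nbar : ℝ) : Mode →L[ℂ] Mode :=
  ∑' n : ℕ, ((nbar ^ n / (nbar + 1) ^ (n + 1) : ℝ) : ℂ) •
    InnerProductSpace.rankOne ℂ (fock n) (fock n)

/-- The vacuum state `|0⟩⟨0|`. -/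
def vacuumState : Mode →L[ℂ] Mode := InnerProductSpace.rankOne ℂ (fock 0) (fock 0)

/-! ### Two-mode Gaussian unitaries -/

/-- The linear map `x ↦ M⁻¹ x` of the plane. -/
def planeInv (M : Matrix.SpecialLinearGroup (Fin 2) ℝ) : (ℝ × ℝ) →ₗ[ℝ] (ℝ × ℝ) :=
  Matrix.toLin (Module.Basis.finTwoProd ℝ) (Module.Basis.finTwoProd ℝ)
    (M⁻¹ : Matrix.SpecialLinearGroup (Fin 2) ℝ).1

theorem measurePreserving_planeInv (M : Matrix.SpecialLinearGroup (Fin 2) ℝ) :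
    MeasurePreserving (planeInv M) (volume : Measure (ℝ × ℝ)) volume := by
  have hdet : LinearMap.det (planeInv M) = 1 := by
    rw [planeInv, LinearMap.det_toLin]
    exact (M⁻¹).2
  refine ⟨(LinearMap.continuous_of_finiteDimensional _).measurable, ?_⟩
  rw [Measure.map_linearMap_addHaar_eq_smul_addHaar volume (by rw [hdet]; exact one_ne_zero)]
  simp [hdet]

/-- The two-mode Gaussian unitary `(U f)(x) = f(M⁻¹ x)`. In the Heisenberg picture
`U† q̂ U = M q̂` and `U† p̂ U = (Mᵀ)⁻¹ p̂`, where `q̂ = (q̂₁, q̂₂)` and `p̂ = (p̂₁, p̂₂)`. -/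
def positionUnitary (M : Matrix.SpecialLinearGroup (Fin 2) ℝ) : TwoMode →L[ℂ] TwoMode :=
  (Lp.compMeasurePreservingₗᵢ ℂ (planeInv M)
    (measurePreserving_planeInv M)).toContinuousLinearMap

/-- The action of the beam splitter of transmissivity `η` on `(q̂₁, q̂₂)`; the matrix is orthogonal,
so `(p̂₁, p̂₂)` transforms in the same way. -/
def beamSplitterMatrix (η : ℝ) (hη : η ∈ Set.Icc (0 : ℝ) 1) :
    Matrix.SpecialLinearGroup (Fin 2) ℝ :=
  ⟨!![Real.sqrt η, Real.sqrt (1 - η); -Real.sqrt (1 - η), Real.sqrt η], by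
    rw [Matrix.det_fin_two_of]
    have h1 := Real.mul_self_sqrt hη.1
    have h2 := Real.mul_self_sqrt (sub_nonneg.2 hη.2)
    linarith⟩

/-- The beam splitter unitary `B̂(η)`: `B̂† â₁ B̂ = √η â₁ + √(1-η) â₂` and
`B̂† â₂ B̂ = -√(1-η) â₁ + √η â₂`. -/
def beamSplitter (η : ℝ) (hη : η ∈ Set.Icc (0 : ℝ) 1) : TwoMode →L[ℂ] TwoMode :=
  positionUnitary (beamSplitterMatrix η hη)

/-- The action of the two-mode squeezing of gain `G` on `(q̂₁, q̂₂)`; its inverse transpose, the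
action on `(p̂₁, p̂₂)`, has the opposite signs off the diagonal. -/
def twoModeSqueezingMatrix (G : ℝ) (hG : 1 ≤ G) : Matrix.SpecialLinearGroup (Fin 2) ℝ :=
  ⟨!![Real.sqrt G, Real.sqrt (G - 1); Real.sqrt (G - 1), Real.sqrt G], by
    rw [Matrix.det_fin_two_of]
    have h1 := Real.mul_self_sqrt (zero_le_one.trans hG)
    have h2 := Real.mul_self_sqrt (sub_nonneg.2 hG)
    linarith⟩

/-- The two-mode squeezing unitary `Ŝ₂(G)`: `Ŝ₂† â₁ Ŝ₂ = √G â₁ + √(G-1) â₂†` and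
`Ŝ₂† â₂ Ŝ₂ = √(G-1) â₁† + √G â₂`. -/
def twoModeSqueezing (G : ℝ) (hG : 1 ≤ G) : TwoMode →L[ℂ] TwoMode :=
  positionUnitary (twoModeSqueezingMatrix G hG)

/-! ### Displacement operators -/

/-- The phase factor `exp(i (p x - p q / 2))` with `(q, p) = √2 (Re α, Im α)`. -/
def displacementPhase (α : ℂ) (x : ℝ) : ℂ :=
  Complex.exp (Complex.I * ((Real.sqrt 2 * α.im * x - α.re * α.im : ℝ) : ℂ))

theorem norm_displacementPhase (α : ℂ) (x : ℝ) : ‖displacementPhase α x‖ = 1 := by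
  rw [displacementPhase, mul_comm, Complex.norm_exp_ofReal_mul_I]

theorem memLp_displacement (α : ℂ) (ψ : Mode) :
    MemLp (fun x : ℝ => displacementPhase α x * ψ (x - Real.sqrt 2 * α.re)) 2
      (volume : Measure ℝ) := by
  have h := (Lp.memLp ψ).comp_measurePreserving
    (measurePreserving_sub_right (volume : Measure ℝ) (Real.sqrt 2 * α.re))
  have hc : Continuous (displacementPhase α) := by unfold displacementPhase; fun_prop
  refine h.of_le (hc.aestronglyMeasurable.mul h.1) (Filter.Eventually.of_forall fun x => ?_)
  simp [norm_displacementPhase]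

theorem ae_sub {P : ℝ → Prop} (h : ∀ᵐ x : ℝ, P x) (c : ℝ) : ∀ᵐ x : ℝ, P (x - c) :=
  (measurePreserving_sub_right (volume : Measure ℝ) c).quasiMeasurePreserving.ae h

/-- The displacement operator `D̂(α) = exp(α â† - α* â) = exp(i (p q̂ - q p̂))`, where
`(q, p) = √2 (Re α, Im α)`; explicitly `(D̂(α) ψ)(x) = exp(i (p x - p q / 2)) ψ(x - q)`. -/
def displacement (α : ℂ) : Mode →L[ℂ] Mode :=
  LinearMap.mkContinuous
    { toFun := fun ψ => (memLp_displacement α ψ).toLp _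
      map_add' := fun ψ φ => by
        apply Lp.ext
        filter_upwards [(memLp_displacement α (ψ + φ)).coeFn_toLp,
          (memLp_displacement α ψ).coeFn_toLp, (memLp_displacement α φ).coeFn_toLp,
          Lp.coeFn_add ((memLp_displacement α ψ).toLp _) ((memLp_displacement α φ).toLp _),
          ae_sub (Lp.coeFn_add ψ φ) (Real.sqrt 2 * α.re)] with x h1 h2 h3 h4 h5
        rw [h1, h4, Pi.add_apply, h2, h3, h5, Pi.add_apply, mul_add]
      map_smul' := fun c ψ => by
        apply Lp.ext
        filter_upwards [(memLp_displacement α (c • ψ)).coeFn_toLp,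
          (memLp_displacement α ψ).coeFn_toLp,
          Lp.coeFn_smul c ((memLp_displacement α ψ).toLp _),
          ae_sub (Lp.coeFn_smul c ψ) (Real.sqrt 2 * α.re)] with x h1 h2 h3 h4
        rw [h1, RingHom.id_apply, h3, Pi.smul_apply, h2, h4, Pi.smul_apply, smul_eq_mul,
          smul_eq_mul, mul_left_comm] }
    1 (fun ψ => by
      have hmp := measurePreserving_sub_right (volume : Measure ℝ) (Real.sqrt 2 * α.re)
      rw [one_mul, ← Lp.norm_compMeasurePreserving ψ hmp]
      apply Lp.norm_le_norm_of_ae_le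
      filter_upwards [(memLp_displacement α ψ).coeFn_toLp,
        Lp.coeFn_compMeasurePreserving ψ hmp] with x h1 h2
      change ‖((memLp_displacement α ψ).toLp _ : Mode) x‖ ≤ _
      rw [h1, h2, norm_mul, norm_displacementPhase, one_mul]
      rfl)

/-! ### Channels -/

/-- The Gaussian loss channel `𝒩[η, n̄](ρ) = Tr₂[B̂(η) (ρ ⊗ ρ_n̄) B̂(η)†]`. -/
def lossChannel (η : ℝ) (hη : η ∈ Set.Icc (0 : ℝ) 1) (nbar : ℝ) (ρ : Mode →L[ℂ] Mode) :
    Mode →L[ℂ] Mode :=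
  partialTrace (beamSplitter η hη ∘L opTensor ρ (thermalState nbar) ∘L
    (beamSplitter η hη).adjoint)

/-- The quantum-limited amplification channel `𝒜[G](ρ) = Tr₂[Ŝ₂(G) (ρ ⊗ |0⟩⟨0|) Ŝ₂(G)†]`. -/
def amplifier (G : ℝ) (hG : 1 ≤ G) (ρ : Mode →L[ℂ] Mode) : Mode →L[ℂ] Mode :=
  partialTrace (twoModeSqueezing G hG ∘L opTensor ρ vacuumState ∘L
    (twoModeSqueezing G hG).adjoint)

/-- The Gaussian random displacement channel
`ρ ↦ (1 / (π σ²)) ∫ exp(-|α|² / σ²) D̂(α) ρ D̂(α)† d²α` of variance `v = σ²`; for `v = 0` the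
Gaussian law is the point mass at `α = 0`, so the channel is the identity. -/
def randomDisplacement (v : ℝ) (ρ : Mode →L[ℂ] Mode) : Mode →L[ℂ] Mode :=
  if v = 0 then ρ
  else (1 / (Real.pi * v)) • ∫ α : ℂ, Real.exp (-‖α‖ ^ 2 / v) •
    (displacement α ∘L ρ ∘L (displacement α).adjoint)

/-- The variance `(1 - η)(n̄ + 1)` for amplification before the loss. -/
def preAmpVariance (η nbar : ℝ) : ℝ := (1 - η) * (nbar + 1)

/-- The variance `((1 - η) / η)(n̄ + 1)` for amplification after the loss. -/
def postAmpVariance (η nbar : ℝ) : ℝ := (1 - η) / η * (nbar + 1)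

end Bosonic

end

namespace Bosonic

noncomputable section

open MeasureTheory
open scoped ComplexConjugate InnerProductSpace
open InnerProductSpace (rankOne)
open Polynomial (hermite derivative)

/-! ### Product vectors -/

/-! A trace class operator `T` is determined by its characteristic function `χ(ξ) = Tr[T D̂(ξ)]`,
and each channel acts on `χ` by a dilation and a Gaussian factor. A dilation `T ↦ Tr₂[U (T ⊗ B) U†]`
with Gaussian `U` sends `χ` to `χ` times the characteristic function of `B`, both at linearly
transformed arguments (`HasCharFun.partialTrace_positionUnitary`). The thermal state has `exp(-(n̄ +
1/2)|ξ|²)`. Amplification by `1/η` and loss `η` undo each other's dilation, and the exponents add up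
to `(1-η)/2 + (n̄ + 1/2)(1-η) = (1-η)(n̄ + 1)`. A Gaussian mixture of displacements of variance `v`
multiplies `χ` by `exp(-v|ξ|²)`, a Gaussian Fourier transform.

Injectivity comes from `|0⟩⟨0| = (1/π) ∫ exp(-|ξ|²/2) D̂(ξ) d²ξ`, read weakly
(`integral_inner_displacement`): it expresses the matrix elements of `T` between coherent states
through `χ` (`HasCharFun.inner_coherent`), and coherent states are total.

Traces are handled by expansions `T = ∑ᵢ |uᵢ⟩⟨wᵢ|` with square-summable `u`, `w`. These exist for
trace class operators and survive tensor products, conjugations and partial traces, so every trace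
is an absolutely convergent series. -/

theorem inner_tmul (ψ φ ψ' φ' : Mode) :
    inner ℂ (tmul ψ φ) (tmul ψ' φ') = inner ℂ ψ ψ' * inner ℂ φ φ' := by
  rw [L2.inner_def, L2.inner_def, L2.inner_def, ← integral_prod_mul]
  apply integral_congr_ae
  filter_upwards [coeFn_tmul ψ φ, coeFn_tmul ψ' φ'] with z h1 h2
  rw [h1, h2]
  simp only [RCLike.inner_apply, map_mul]
  ring

theorem tmul_add_right (ψ φ φ' : Mode) : tmul ψ (φ + φ') = tmul ψ φ + tmul ψ φ' := by
  apply Lp.ext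
  have h : ∀ᵐ z : ℝ × ℝ, (φ + φ' : Mode) z.2 = φ z.2 + φ' z.2 :=
    Measure.quasiMeasurePreserving_snd.ae (Lp.coeFn_add φ φ')
  filter_upwards [coeFn_tmul ψ (φ + φ'), coeFn_tmul ψ φ, coeFn_tmul ψ φ',
    Lp.coeFn_add (tmul ψ φ) (tmul ψ φ'), h] with z h1 h2 h3 h4 h5
  simp only [h1, h4, Pi.add_apply, h2, h3, h5, mul_add]

theorem tmul_smul_right (c : ℂ) (ψ φ : Mode) : tmul ψ (c • φ) = c • tmul ψ φ := by
  apply Lp.ext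
  have h : ∀ᵐ z : ℝ × ℝ, (c • φ : Mode) z.2 = c • φ z.2 :=
    Measure.quasiMeasurePreserving_snd.ae (Lp.coeFn_smul c φ)
  filter_upwards [coeFn_tmul ψ (c • φ), coeFn_tmul ψ φ, Lp.coeFn_smul c (tmul ψ φ), h]
    with z h1 h2 h3 h4
  simp only [h1, h3, Pi.smul_apply, h2, h4, smul_eq_mul, mul_left_comm]

/-- The bounded operator `φ ↦ ψ ⊗ φ`. -/
def tensorLeft (ψ : Mode) : Mode →L[ℂ] TwoMode :=
  LinearMap.mkContinuous
    { toFun := fun φ => tmul ψ φ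
      map_add' := fun φ φ' => tmul_add_right ψ φ φ'
      map_smul' := fun c φ => tmul_smul_right c ψ φ }
    ‖ψ‖ (fun φ => by
      change ‖tmul ψ φ‖ ≤ _
      rw [norm_tmul])

theorem tensorLeft_apply (ψ φ : Mode) : tensorLeft ψ φ = tmul ψ φ := rfl

theorem tensorRight_apply (ψ φ : Mode) : tensorRight φ ψ = tmul ψ φ := rfl

theorem adjoint_tensorRight_tmul (w ψ φ : Mode) :
    (tensorRight w).adjoint (tmul ψ φ) = inner ℂ w φ • ψ := by
  refine ext_inner_left ℂ fun v => ?_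
  rw [ContinuousLinearMap.adjoint_inner_right, tensorRight_apply, inner_tmul, inner_smul_right,
    mul_comm]

theorem fockFun_zero (x : ℝ) :
    fockFun 0 x = ((Real.sqrt (Real.sqrt Real.pi))⁻¹ * Real.exp (-x ^ 2 / 2) : ℝ) := by
  simp [fockFun]

theorem fockFun_zero_ne_zero (x : ℝ) : fockFun 0 x ≠ 0 := by
  rw [fockFun_zero, Complex.ofReal_ne_zero]
  have := Real.pi_pos
  positivity

theorem conj_fockFun (n : ℕ) (x : ℝ) : conj (fockFun n x) = fockFun n x := by
  rw [fockFun, Complex.conj_ofReal]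

theorem coeFn_fock (n : ℕ) : fock n =ᵐ[volume] fockFun n := MemLp.coeFn_toLp _

/-- A vector orthogonal to all product vectors vanishes. -/
theorem eq_zero_of_forall_inner_tmul {Ψ : TwoMode} (h : ∀ ψ φ, inner ℂ (tmul ψ φ) Ψ = 0) :
    Ψ = 0 := by
  -- The nowhere vanishing Gaussian factor makes `F` integrable and can be divided out at the end.
  -- Testing `Ψ` against vacuum wave functions cut off to `s` and `t` gives the integrals of `F`
  -- over rectangles, which form a π-system.
  set F : ℝ × ℝ → ℂ := fun z => Ψ z * (fockFun 0 z.1 * fockFun 0 z.2) with hF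
  have hae : tmul (fock 0) (fock 0) =ᵐ[volume] fun z : ℝ × ℝ => fockFun 0 z.1 * fockFun 0 z.2 := by
    filter_upwards [coeFn_tmul (fock 0) (fock 0),
      Measure.quasiMeasurePreserving_fst.ae (coeFn_fock 0),
      Measure.quasiMeasurePreserving_snd.ae (coeFn_fock 0)] with z h1 h2 h3
    rw [h1, h2, h3]
  have hInt : Integrable F := by
    refine (L2.integrable_inner (𝕜 := ℂ) (tmul (fock 0) (fock 0)) Ψ).congr ?_
    filter_upwards [hae] with z hz
    rw [hz]
    simp [hF, conj_fockFun]
  have hrect : ∀ s t : Set ℝ, MeasurableSet s → MeasurableSet t → ∫ z in s ×ˢ t, F z = 0 := by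
    intro s t hs ht
    have hs' := (memLp_fockFun 0).indicator hs
    have ht' := (memLp_fockFun 0).indicator ht
    rw [← h (hs'.toLp _) (ht'.toLp _), L2.inner_def, ← integral_indicator (hs.prod ht)]
    apply integral_congr_ae
    filter_upwards [coeFn_tmul (hs'.toLp _) (ht'.toLp _),
      Measure.quasiMeasurePreserving_fst.ae hs'.coeFn_toLp,
      Measure.quasiMeasurePreserving_snd.ae ht'.coeFn_toLp] with z h1 h2 h3
    rw [h1, h2, h3]
    by_cases a : z.1 ∈ s <;> by_cases b : z.2 ∈ t <;>
      simp [Set.indicator, a, b, hF, Set.mem_prod, conj_fockFun]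
  have hset : ∀ s : Set (ℝ × ℝ), MeasurableSet s → ∫ z in s, F z = 0 := by
    intro s hs
    induction s, hs using MeasurableSpace.induction_on_inter generateFrom_prod.symm
      isPiSystem_prod with
    | empty => simp
    | basic t ht =>
      obtain ⟨a, ha, b, hb, rfl⟩ := ht
      exact hrect a b ha hb
    | compl t ht ih =>
      have hu := hrect Set.univ Set.univ .univ .univ
      rw [Set.univ_prod_univ, setIntegral_univ] at hu
      have := integral_add_compl ht hInt
      rw [ih, hu, zero_add] at this
      exact this
    | iUnion f hd hm ih =>
      rw [integral_iUnion hm hd hInt.integrableOn]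
      simp [ih]
  have h0 := hInt.ae_eq_zero_of_forall_setIntegral_eq_zero fun s hs _ => hset s hs
  apply Lp.ext
  filter_upwards [h0, Lp.coeFn_zero ℂ 2 (volume : Measure (ℝ × ℝ))] with z hz hz'
  rw [hz']
  simpa [hF, fockFun_zero_ne_zero] using hz

/-- Every vector in the range of `(S - T)†` is orthogonal to all product vectors. -/
theorem clm_ext_tmul {H : Type*} [NormedAddCommGroup H] [InnerProductSpace ℂ H] [CompleteSpace H]
    {S T : TwoMode →L[ℂ] H} (h : ∀ ψ φ, S (tmul ψ φ) = T (tmul ψ φ)) : S = T := by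
  rw [← sub_eq_zero, ← map_eq_zero_iff _ (ContinuousLinearMap.adjoint).injective]
  ext1 Ψ
  refine eq_zero_of_forall_inner_tmul fun ψ φ => ?_
  rw [ContinuousLinearMap.adjoint_inner_right]
  simp [h]

/-! ### The product basis -/

theorem orthonormal_tmul_modeBasis :
    Orthonormal ℂ fun p : modeIndex × modeIndex => tmul (modeBasis p.1) (modeBasis p.2) := by
  classical
  have hb := orthonormal_iff_ite.1 modeBasis.orthonormal
  rw [orthonormal_iff_ite]
  rintro ⟨i, j⟩ ⟨i', j'⟩
  rw [inner_tmul, hb, hb]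
  by_cases a : i = i' <;> by_cases b : j = j' <;> simp [a, b]

/-- All coordinates of `A†v` vanish. Applied once in each tensor factor, this passes from products
of basis vectors to all product vectors. -/
theorem eq_zero_of_forall_inner_modeBasis {H : Type*} [NormedAddCommGroup H]
    [InnerProductSpace ℂ H] [CompleteSpace H] {A : Mode →L[ℂ] H} {v : H}
    (h : ∀ i, inner ℂ (A (modeBasis i)) v = 0) (ψ : Mode) : inner ℂ (A ψ) v = 0 := by
  have : A.adjoint v = 0 := by
    rw [← modeBasis.repr.map_eq_zero_iff]
    ext i
    rw [modeBasis.repr_apply_apply, ContinuousLinearMap.adjoint_inner_right, h]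
    rfl
  rw [← ContinuousLinearMap.adjoint_inner_right, this, inner_zero_right]

theorem span_tmul_modeBasis_dense :
    ⊤ ≤ (Submodule.span ℂ (Set.range fun p : modeIndex × modeIndex =>
      tmul (modeBasis p.1) (modeBasis p.2))).topologicalClosure := by
  rw [top_le_iff, Submodule.topologicalClosure_eq_top_iff, Submodule.eq_bot_iff]
  intro Ψ hΨ
  rw [Submodule.mem_orthogonal] at hΨ
  refine eq_zero_of_forall_inner_tmul fun ψ φ => ?_
  refine eq_zero_of_forall_inner_modeBasis (A := tensorLeft ψ) (fun k => ?_) φ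
  refine eq_zero_of_forall_inner_modeBasis (A := tensorRight (modeBasis k)) (fun j => ?_) ψ
  exact hΨ _ (Submodule.subset_span ⟨(j, k), rfl⟩)

/-- The product basis `eⱼ ⊗ eₖ` of the two-mode space. -/
def twoModeBasis : HilbertBasis (modeIndex × modeIndex) ℂ TwoMode :=
  HilbertBasis.mk orthonormal_tmul_modeBasis span_tmul_modeBasis_dense

theorem twoModeBasis_apply (p : modeIndex × modeIndex) :
    twoModeBasis p = tmul (modeBasis p.1) (modeBasis p.2) := by
  simp [twoModeBasis]

/-- Weak form of `∑ₖ Rₖ Rₖ† = 1` for `Rₖ = tensorRight (modeBasis k)`: Parseval in the product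
basis, with the first index summed before the second. -/
theorem hasSum_inner_adjoint_tensorRight (Φ Ψ : TwoMode) :
    HasSum (fun k => inner ℂ ((tensorRight (modeBasis k)).adjoint Φ)
      ((tensorRight (modeBasis k)).adjoint Ψ)) (inner ℂ Φ Ψ) := by
  have h := (Equiv.prodComm modeIndex modeIndex).hasSum_iff.2
    (twoModeBasis.hasSum_inner_mul_inner Φ Ψ)
  refine h.prod_fiberwise fun k => ?_
  have h' := modeBasis.hasSum_inner_mul_inner ((tensorRight (modeBasis k)).adjoint Φ)
    ((tensorRight (modeBasis k)).adjoint Ψ)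
  simpa only [Function.comp_def, Equiv.prodComm_apply, Prod.swap_prod_mk, twoModeBasis_apply,
    ContinuousLinearMap.adjoint_inner_left, ContinuousLinearMap.adjoint_inner_right,
    tensorRight_apply] using h'

theorem hasSum_norm_sq_adjoint_tensorRight (Φ : TwoMode) :
    HasSum (fun k => ‖(tensorRight (modeBasis k)).adjoint Φ‖ ^ 2) (‖Φ‖ ^ 2) := by
  have h := hasSum_inner_adjoint_tensorRight Φ Φ
  simp only [inner_self_eq_norm_sq_to_K] at h
  exact_mod_cast h

/-! ### Nuclear expansions -/

section Nuclear

variable {H : Type*} [NormedAddCommGroup H] [InnerProductSpace ℂ H]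

/-- `T = ∑ᵢ |uᵢ⟩⟨wᵢ|` with square-summable families `u` and `w`. -/
structure IsNuclearSum {ι : Type*} (u w : ι → H) (T : H →L[ℂ] H) : Prop where
  left : Summable fun i => ‖u i‖ ^ 2
  right : Summable fun i => ‖w i‖ ^ 2
  hasSum : HasSum (fun i => rankOne ℂ (u i) (w i)) T

theorem summable_mul_of_sq {ι : Type*} {a b : ι → ℝ} (ha0 : ∀ i, 0 ≤ a i) (hb0 : ∀ i, 0 ≤ b i)
    (ha : Summable fun i => a i ^ 2) (hb : Summable fun i => b i ^ 2) :
    Summable fun i => a i * b i := by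
  refine Summable.of_nonneg_of_le (fun i => mul_nonneg (ha0 i) (hb0 i)) (fun i => ?_) (ha.add hb)
  nlinarith [sq_nonneg (a i - b i), sq_nonneg (a i), sq_nonneg (b i)]

theorem summable_rankOne [CompleteSpace H] {ι : Type*} {u w : ι → H}
    (hu : Summable fun i => ‖u i‖ ^ 2) (hw : Summable fun i => ‖w i‖ ^ 2) :
    Summable fun i => rankOne ℂ (u i) (w i) := by
  refine Summable.of_norm ?_
  simp only [InnerProductSpace.norm_rankOne]
  exact summable_mul_of_sq (fun _ => norm_nonneg _) (fun _ => norm_nonneg _) hu hw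

/-- The norms `‖uᵢ‖ ‖wᵢ‖` are summable, so the series converges in operator norm; pointwise
convergence only has to identify the limit. -/
theorem IsNuclearSum.of_summable [CompleteSpace H] {ι : Type*} {u w : ι → H} {T : H →L[ℂ] H}
    (hu : Summable fun i => ‖u i‖ ^ 2) (hw : Summable fun i => ‖w i‖ ^ 2)
    (h : ∀ x, HasSum (fun i => inner ℂ (w i) x • u i) (T x)) : IsNuclearSum u w T := by
  refine ⟨hu, hw, ?_⟩
  have hs := (summable_rankOne hu hw).hasSum
  convert hs using 1
  ext1 x
  exact (h x).unique (hs.mapL (ContinuousLinearMap.apply ℂ H x))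

/-- The sum of this series is the trace of `A T`. -/
theorem IsNuclearSum.summable_inner {ι : Type*} {u w : ι → H} {T : H →L[ℂ] H}
    (h : IsNuclearSum u w T) (A : H →L[ℂ] H) (hA : ‖A‖ ≤ 1) :
    Summable fun i => inner ℂ (w i) (A (u i)) := by
  refine Summable.of_norm_bounded
    (summable_mul_of_sq (fun _ => norm_nonneg _) (fun _ => norm_nonneg _) h.right h.left)
    fun i => (norm_inner_le_norm _ _).trans ?_
  gcongr
  exact (A.le_of_opNorm_le hA _).trans (one_mul _).le

theorem IsNuclearSum.conj [CompleteSpace H] {ι : Type*} {u w : ι → H} {T : H →L[ℂ] H}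
    (h : IsNuclearSum u w T) {K : Type*} [NormedAddCommGroup K] [InnerProductSpace ℂ K]
    [CompleteSpace K] (A B : H →L[ℂ] K) :
    IsNuclearSum (fun i => A (u i)) (fun i => B (w i)) (A ∘L T ∘L B.adjoint) := by
  have aux : ∀ (C : H →L[ℂ] K) (v : ι → H), (Summable fun i => ‖v i‖ ^ 2) →
      Summable fun i => ‖C (v i)‖ ^ 2 := fun C v hv => by
    refine Summable.of_nonneg_of_le (fun _ => by positivity) (fun i => ?_) (hv.mul_left (‖C‖ ^ 2))
    rw [← mul_pow]
    gcongr
    exact C.le_opNorm _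
  refine .of_summable (aux A u h.left) (aux B w h.right) fun x => ?_
  have := (h.hasSum.mapL (ContinuousLinearMap.apply ℂ H (B.adjoint x))).mapL A
  simpa [ContinuousLinearMap.adjoint_inner_right] using this

/-- Operators with a countable nuclear expansion. -/
def IsNuclear (T : H →L[ℂ] H) : Prop :=
  ∃ (ι : Type) (_ : Countable ι) (u w : ι → H), IsNuclearSum u w T

theorem IsNuclear.add [CompleteSpace H] {S T : H →L[ℂ] H} (hS : IsNuclear S) (hT : IsNuclear T) :
    IsNuclear (S + T) := by
  obtain ⟨ι, _, u, w, h⟩ := hS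
  obtain ⟨κ, _, u', w', h'⟩ := hT
  refine ⟨ι ⊕ κ, inferInstance, Sum.elim u u', Sum.elim w w', ?_, ?_, ?_⟩
  · exact (HasSum.sum (f := fun i => ‖Sum.elim u u' i‖ ^ 2) h.left.hasSum h'.left.hasSum).summable
  · exact (HasSum.sum (f := fun i => ‖Sum.elim w w' i‖ ^ 2) h.right.hasSum h'.right.hasSum).summable
  · exact HasSum.sum (f := fun i => rankOne ℂ (Sum.elim u u' i) (Sum.elim w w' i))
      h.hasSum h'.hasSum

theorem IsNuclear.smul {T : H →L[ℂ] H} (hT : IsNuclear T) (c : ℂ) : IsNuclear (c • T) := by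
  obtain ⟨ι, _, u, w, h⟩ := hT
  refine ⟨ι, inferInstance, fun i => c • u i, w, ?_, h.right, ?_⟩
  · simpa [norm_smul, mul_pow] using h.left.mul_left (‖c‖ ^ 2)
  · simpa using h.hasSum.const_smul c

theorem isNuclear_zero : IsNuclear (0 : H →L[ℂ] H) :=
  ⟨Empty, inferInstance, fun _ => 0, fun _ => 0, summable_empty, summable_empty, hasSum_empty⟩

theorem exists_isSymmetric_sqrt [CompleteSpace H] {T : H →L[ℂ] H} (hT : T.IsPositive) :
    ∃ A : H →L[ℂ] H, (∀ x y, inner ℂ (A x) y = inner ℂ x (A y)) ∧ ∀ x, A (A x) = T x := by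
  have h0 : 0 ≤ T := (ContinuousLinearMap.nonneg_iff_isPositive T).2 hT
  refine ⟨CFC.sqrt T,
    ((ContinuousLinearMap.nonneg_iff_isPositive _).1 (CFC.sqrt_nonneg T)).isSymmetric, fun x => ?_⟩
  rw [← mul_apply_eq_comp, CFC.sqrt_mul_sqrt_self T h0]

end Nuclear

/-! ### Trace class operators have countable nuclear expansions -/

/-- Distinct basis vectors are `√2` apart, so the balls are disjoint, and `L²(ℝ)` is separable.
Countability is needed to exchange trace series with integrals. -/
instance countable_modeIndex : Countable modeIndex := by
  have : Fact ((2 : ENNReal) ≠ ⊤) := ⟨ENNReal.ofNat_ne_top⟩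
  have hd : Pairwise (Function.onFun Disjoint fun i : modeIndex =>
      Metric.ball (modeBasis i) (1 / 2)) := fun i j hij => by
    refine Metric.ball_disjoint_ball ?_
    have h1 := modeBasis.orthonormal.1
    have h2 : ‖modeBasis i - modeBasis j‖ ^ 2 = 2 := by
      rw [@norm_sub_sq ℂ, h1, h1, modeBasis.orthonormal.2 hij]
      norm_num
    rw [dist_eq_norm]
    nlinarith [norm_nonneg (modeBasis i - modeBasis j)]
  exact Pairwise.countable_of_isOpen_disjoint hd (fun _ => Metric.isOpen_ball) fun i =>
    ⟨modeBasis i, Metric.mem_ball_self (by norm_num)⟩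

/-- With `A = √ρ` one has `ρ = ∑ᵢ A|eᵢ⟩⟨eᵢ|A`, and `‖A eᵢ‖² = ⟨eᵢ|ρ|eᵢ⟩` is summable because the
trace is finite. -/
theorem IsDensityOperator.isNuclear {ρ : Mode →L[ℂ] Mode} (h : IsDensityOperator ρ) :
    IsNuclear ρ := by
  obtain ⟨A, hAs, hAA⟩ := exists_isSymmetric_sqrt h.1
  have hsq : ∀ x, inner ℂ x (ρ x) = ((‖A x‖ ^ 2 : ℝ) : ℂ) := fun x => by
    rw [← hAA, ← hAs, inner_self_eq_norm_sq_to_K]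
    norm_cast
  have hs : Summable fun i => ‖A (modeBasis i)‖ ^ 2 := by
    have := h.2.summable
    simp only [hsq] at this
    exact_mod_cast this
  refine ⟨modeIndex, inferInstance, fun i => A (modeBasis i), fun i => A (modeBasis i),
    .of_summable hs hs fun x => ?_⟩
  have := (modeBasis.hasSum_repr (A x)).mapL A
  rw [hAA] at this
  simpa [modeBasis.repr_apply_apply, hAs] using this

theorem isNuclear_of_mem_traceClass {ρ : Mode →L[ℂ] Mode} (h : ρ ∈ traceClass) : IsNuclear ρ := by
  induction h using Submodule.span_induction with
  | mem x hx => exact IsDensityOperator.isNuclear hx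
  | zero => exact isNuclear_zero
  | add x y _ _ hx hy => exact hx.add hy
  | smul c x _ hx => exact hx.smul c

/-! ### Tensor products and partial traces of nuclear expansions -/

theorem summable_sq_norm_mul {ι κ : Type*} {E F : Type*} [NormedAddCommGroup E]
    [NormedAddCommGroup F] {u : ι → E} {v : κ → F}
    (hu : Summable fun i => ‖u i‖ ^ 2) (hv : Summable fun j => ‖v j‖ ^ 2) :
    Summable fun p : ι × κ => (‖u p.1‖ * ‖v p.2‖) ^ 2 := by
  simp only [mul_pow]
  exact Summable.mul_of_nonneg hu hv (fun _ => by positivity) fun _ => by positivity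

/-- Product vectors determine a bounded operator, so the choice made in `opTensor` is immaterial. -/
theorem opTensor_eq {A B : Mode →L[ℂ] Mode} {T : TwoMode →L[ℂ] TwoMode}
    (h : ∀ ψ φ, T (tmul ψ φ) = tmul (A ψ) (B φ)) : opTensor A B = T := by
  have hex : ∃ T : TwoMode →L[ℂ] TwoMode, ∀ ψ φ, T (tmul ψ φ) = tmul (A ψ) (B φ) := ⟨T, h⟩
  rw [opTensor, dif_pos hex]
  exact clm_ext_tmul fun ψ φ => (hex.choose_spec ψ φ).trans (h ψ φ).symm

/-- The double series itself supplies a bounded operator with the right values on product vectors,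
so `opTensor` does not fall back to its default `0`. -/
theorem IsNuclearSum.opTensor {ι κ : Type*} {u w : ι → Mode} {v v' : κ → Mode}
    {A B : Mode →L[ℂ] Mode} (hA : IsNuclearSum u w A) (hB : IsNuclearSum v v' B) :
    IsNuclearSum (fun p : ι × κ => tmul (u p.1) (v p.2)) (fun p => tmul (w p.1) (v' p.2))
      (opTensor A B) := by
  have hl : Summable fun p : ι × κ => ‖tmul (u p.1) (v p.2)‖ ^ 2 := by
    simpa only [norm_tmul] using summable_sq_norm_mul hA.left hB.left
  have hr : Summable fun p : ι × κ => ‖tmul (w p.1) (v' p.2)‖ ^ 2 := by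
    simpa only [norm_tmul] using summable_sq_norm_mul hA.right hB.right
  have hs := (summable_rankOne hl hr).hasSum
  refine ⟨hl, hr, ?_⟩
  convert hs using 1
  refine opTensor_eq fun ψ φ => ?_
  have h1 := hs.mapL (ContinuousLinearMap.apply ℂ TwoMode (tmul ψ φ))
  have h2 : ∀ i, HasSum (fun j => rankOne ℂ (tmul (u i) (v j)) (tmul (w i) (v' j)) (tmul ψ φ))
      (tmul (inner ℂ (w i) ψ • u i) (B φ)) := fun i => by
    convert (hB.hasSum.mapL (ContinuousLinearMap.apply ℂ Mode φ)).mapL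
      (tensorLeft (inner ℂ (w i) ψ • u i)) using 2 with j
    simp only [ContinuousLinearMap.apply_apply, InnerProductSpace.rankOne_apply, map_smul,
      tensorLeft_apply, tmul_smul_left, inner_tmul]
    · rw [smul_smul, mul_comm]
    · rfl
  have h3 := (hA.hasSum.mapL (ContinuousLinearMap.apply ℂ Mode ψ)).mapL (tensorRight (B φ))
  exact (h1.prod_fiberwise h2).unique h3

/-- Square-summability persists because `∑ₖ ‖Rₖ†Φ‖² = ‖Φ‖²`. Summing the absolutely convergent
double series over `ι` first recovers the series defining `partialTrace`. -/
theorem IsNuclearSum.partialTrace {ι : Type*} {Φ Ψ : ι → TwoMode} {T : TwoMode →L[ℂ] TwoMode}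
    (h : IsNuclearSum Φ Ψ T) :
    IsNuclearSum (fun p : modeIndex × ι => (tensorRight (modeBasis p.1)).adjoint (Φ p.2))
      (fun p => (tensorRight (modeBasis p.1)).adjoint (Ψ p.2)) (partialTrace T) := by
  have aux : ∀ Φ : ι → TwoMode, (Summable fun i => ‖Φ i‖ ^ 2) → Summable fun p : modeIndex × ι =>
      ‖(tensorRight (modeBasis p.1)).adjoint (Φ p.2)‖ ^ 2 := fun Φ hΦ => by
    rw [← (Equiv.prodComm ι modeIndex).summable_iff]
    refine (summable_prod_of_nonneg fun _ => sq_nonneg _).2 ⟨fun i => ?_, ?_⟩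
    · exact (hasSum_norm_sq_adjoint_tensorRight (Φ i)).summable
    · refine hΦ.congr fun i => ?_
      exact (hasSum_norm_sq_adjoint_tensorRight (Φ i)).tsum_eq.symm
  have hs := (summable_rankOne (aux Φ h.left) (aux Ψ h.right)).hasSum
  refine ⟨aux Φ h.left, aux Ψ h.right, ?_⟩
  convert hs using 1
  refine (hs.prod_fiberwise fun k => ?_).tsum_eq
  simpa using
    (h.conj (tensorRight (modeBasis k)).adjoint (tensorRight (modeBasis k)).adjoint).hasSum

/-- The trace of `A Tr₂(T)` is the trace of `(A ⊗ 1) T`. -/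
theorem IsNuclearSum.hasSum_inner_partialTrace {ι : Type*} {Φ Ψ : ι → TwoMode}
    {T : TwoMode →L[ℂ] TwoMode} (h : IsNuclearSum Φ Ψ T) {A : Mode →L[ℂ] Mode} (hA : ‖A‖ ≤ 1)
    {A₁ : TwoMode →L[ℂ] TwoMode} (hA₁ : ∀ φ Φ, (tensorRight φ).adjoint (A₁ Φ) =
      A ((tensorRight φ).adjoint Φ)) {a : ℂ} (ha : HasSum (fun i => inner ℂ (Ψ i) (A₁ (Φ i))) a) :
    HasSum (fun p : modeIndex × ι => inner ℂ ((tensorRight (modeBasis p.1)).adjoint (Ψ p.2))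
      (A ((tensorRight (modeBasis p.1)).adjoint (Φ p.2)))) a := by
  -- In the opposite order, the sum over the basis collapses by `∑ₖ Rₖ Rₖ† = 1` and leaves the trace
  -- series on the two-mode space.
  have hs := (Equiv.prodComm ι modeIndex).hasSum_iff.2 (h.partialTrace.summable_inner A hA).hasSum
  have h2 := hs.prod_fiberwise (g := fun i => inner ℂ (Ψ i) (A₁ (Φ i))) fun i => by
    simpa [← hA₁] using hasSum_inner_adjoint_tensorRight (Ψ i) (A₁ (Φ i))
  rw [ha.unique h2]
  exact (h.partialTrace.summable_inner A hA).hasSum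

/-! ### Weyl relations -/

theorem coeFn_displacement (α : ℂ) (ψ : Mode) : displacement α ψ =ᵐ[volume]
    fun x => displacementPhase α x * ψ (x - Real.sqrt 2 * α.re) :=
  (memLp_displacement α ψ).coeFn_toLp

/-- The cocycle `exp((α β* - α* β) / 2)` of the Weyl relations. -/
def weylPhase (α β : ℂ) : ℂ := Complex.exp (Complex.I * ((α.im * β.re - α.re * β.im : ℝ) : ℂ))

theorem norm_weylPhase (α β : ℂ) : ‖weylPhase α β‖ = 1 := by
  rw [weylPhase, mul_comm, Complex.norm_exp_ofReal_mul_I]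

theorem displacement_displacement (α β : ℂ) (ψ : Mode) :
    displacement α (displacement β ψ) = weylPhase α β • displacement (α + β) ψ := by
  apply Lp.ext
  filter_upwards [coeFn_displacement α (displacement β ψ), coeFn_displacement (α + β) ψ,
    Lp.coeFn_smul (weylPhase α β) (displacement (α + β) ψ),
    ae_sub (coeFn_displacement β ψ) (Real.sqrt 2 * α.re)] with x h1 h2 h3 h4
  rw [h1, h3, Pi.smul_apply, h2, h4, smul_eq_mul, ← mul_assoc, ← mul_assoc]
  have hx : x - Real.sqrt 2 * α.re - Real.sqrt 2 * β.re = x - Real.sqrt 2 * (α + β).re := by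
    rw [Complex.add_re]; ring
  rw [hx]
  congr 1
  rw [displacementPhase, displacementPhase, displacementPhase, weylPhase, ← Complex.exp_add,
    ← Complex.exp_add]
  congr 1
  rw [← mul_add, ← mul_add]
  congr 1
  norm_cast
  rw [Complex.add_re, Complex.add_im]
  linear_combination -(β.im * α.re) * Real.mul_self_sqrt (zero_le_two : (0 : ℝ) ≤ 2)

theorem displacement_zero (ψ : Mode) : displacement 0 ψ = ψ := by
  apply Lp.ext
  filter_upwards [coeFn_displacement 0 ψ] with x h1
  rw [h1]
  simp [displacementPhase]

theorem weylPhase_neg_self (α : ℂ) : weylPhase (-α) α = 1 := by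
  simp [weylPhase, mul_comm]

theorem displacement_neg_displacement (α : ℂ) (ψ : Mode) :
    displacement (-α) (displacement α ψ) = ψ := by
  rw [displacement_displacement, weylPhase_neg_self, neg_add_cancel, displacement_zero, one_smul]

theorem norm_displacement_le (α : ℂ) : ‖displacement α‖ ≤ 1 :=
  LinearMap.mkContinuous_norm_le _ zero_le_one _

/-- A contraction whose inverse is also a contraction is isometric. -/
theorem norm_displacement_apply (α : ℂ) (ψ : Mode) : ‖displacement α ψ‖ = ‖ψ‖ := by
  have h : ∀ α ψ, ‖displacement α ψ‖ ≤ ‖ψ‖ := fun α ψ =>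
    ((displacement α).le_of_opNorm_le (norm_displacement_le α) ψ).trans (one_mul _).le
  refine le_antisymm (h α ψ) ?_
  simpa only [displacement_neg_displacement] using h (-α) (displacement α ψ)

theorem inner_displacement_displacement (α : ℂ) (ψ φ : Mode) :
    inner ℂ (displacement α ψ) (displacement α φ) = inner ℂ ψ φ :=
  LinearIsometry.inner_map_map
    (⟨(displacement α).toLinearMap, norm_displacement_apply α⟩ : Mode →ₗᵢ[ℂ] Mode) ψ φ

theorem adjoint_displacement (α : ℂ) : (displacement α).adjoint = displacement (-α) := by
  symm
  rw [ContinuousLinearMap.eq_adjoint_iff]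
  intro ψ φ
  rw [← inner_displacement_displacement α]
  congr 1
  simpa using displacement_neg_displacement (-α) ψ

/-! ### Displacing the first of two modes -/

theorem measurePreserving_sub_fst (c : ℝ) : MeasurePreserving (fun z : ℝ × ℝ => (z.1 - c, z.2))
    (volume : Measure (ℝ × ℝ)) volume :=
  (measurePreserving_sub_right (volume : Measure ℝ) c).prod (MeasurePreserving.id volume)

theorem continuous_displacementPhase (α : ℂ) : Continuous (displacementPhase α) := by
  unfold displacementPhase; fun_prop

theorem memLp_displacementFst (α : ℂ) (Φ : TwoMode) :
    MemLp (fun z : ℝ × ℝ => displacementPhase α z.1 * Φ (z.1 - Real.sqrt 2 * α.re, z.2)) 2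
      (volume : Measure (ℝ × ℝ)) := by
  have h := (Lp.memLp Φ).comp_measurePreserving (measurePreserving_sub_fst (Real.sqrt 2 * α.re))
  refine h.of_le (((continuous_displacementPhase α).comp
    continuous_fst).aestronglyMeasurable.mul h.1) (Filter.Eventually.of_forall fun x => ?_)
  simp [norm_displacementPhase]

/-- The operator `D̂(α) ⊗ 1`. -/
def displacementFst (α : ℂ) : TwoMode →L[ℂ] TwoMode :=
  LinearMap.mkContinuous
    { toFun := fun Φ => (memLp_displacementFst α Φ).toLp _
      map_add' := fun Φ Ψ => by
        apply Lp.ext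
        filter_upwards [(memLp_displacementFst α (Φ + Ψ)).coeFn_toLp,
          (memLp_displacementFst α Φ).coeFn_toLp, (memLp_displacementFst α Ψ).coeFn_toLp,
          Lp.coeFn_add ((memLp_displacementFst α Φ).toLp _) ((memLp_displacementFst α Ψ).toLp _),
          (measurePreserving_sub_fst (Real.sqrt 2 * α.re)).quasiMeasurePreserving.ae
            (Lp.coeFn_add Φ Ψ)] with x h1 h2 h3 h4 h5
        rw [h1, h4, Pi.add_apply, h2, h3, h5, Pi.add_apply, mul_add]
      map_smul' := fun c Φ => by
        apply Lp.ext
        filter_upwards [(memLp_displacementFst α (c • Φ)).coeFn_toLp,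
          (memLp_displacementFst α Φ).coeFn_toLp,
          Lp.coeFn_smul c ((memLp_displacementFst α Φ).toLp _),
          (measurePreserving_sub_fst (Real.sqrt 2 * α.re)).quasiMeasurePreserving.ae
            (Lp.coeFn_smul c Φ)] with x h1 h2 h3 h4
        rw [h1, RingHom.id_apply, h3, Pi.smul_apply, h2, h4, Pi.smul_apply, smul_eq_mul,
          smul_eq_mul, mul_left_comm] }
    1 (fun Φ => by
      have hmp := measurePreserving_sub_fst (Real.sqrt 2 * α.re)
      rw [one_mul, ← Lp.norm_compMeasurePreserving Φ hmp]
      apply Lp.norm_le_norm_of_ae_le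
      filter_upwards [(memLp_displacementFst α Φ).coeFn_toLp,
        Lp.coeFn_compMeasurePreserving Φ hmp] with x h1 h2
      change ‖((memLp_displacementFst α Φ).toLp _ : TwoMode) x‖ ≤ _
      rw [h1, h2, norm_mul, norm_displacementPhase, one_mul]
      rfl)

theorem coeFn_displacementFst (α : ℂ) (Φ : TwoMode) : displacementFst α Φ =ᵐ[volume]
    fun z => displacementPhase α z.1 * Φ (z.1 - Real.sqrt 2 * α.re, z.2) :=
  (memLp_displacementFst α Φ).coeFn_toLp

theorem displacementFst_tmul (α : ℂ) (ψ φ : Mode) :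
    displacementFst α (tmul ψ φ) = tmul (displacement α ψ) φ := by
  apply Lp.ext
  filter_upwards [coeFn_displacementFst α (tmul ψ φ), coeFn_tmul (displacement α ψ) φ,
    (measurePreserving_sub_fst (Real.sqrt 2 * α.re)).quasiMeasurePreserving.ae (coeFn_tmul ψ φ),
    Measure.quasiMeasurePreserving_fst.ae (coeFn_displacement α ψ)] with z h1 h2 h3 h4
  rw [h1, h2, h3, h4, mul_assoc]

/-- Supplies the intertwining hypothesis of `IsNuclearSum.hasSum_inner_partialTrace` for `A =
D̂(α)`. -/
theorem adjoint_tensorRight_displacementFst (α : ℂ) (φ : Mode) (Φ : TwoMode) :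
    (tensorRight φ).adjoint (displacementFst α Φ) =
      displacement α ((tensorRight φ).adjoint Φ) := by
  have h : (tensorRight φ).adjoint ∘L displacementFst α =
      displacement α ∘L (tensorRight φ).adjoint := clm_ext_tmul fun ψ χ => by
    simp only [ContinuousLinearMap.comp_apply, displacementFst_tmul, adjoint_tensorRight_tmul,
      map_smul]
  exact congrArg (fun T => T Φ) h

theorem planeInv_apply (M : Matrix.SpecialLinearGroup (Fin 2) ℝ) (z : ℝ × ℝ) :
    planeInv M z = (M.1 1 1 * z.1 - M.1 0 1 * z.2, -M.1 1 0 * z.1 + M.1 0 0 * z.2) := by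
  rw [planeInv, Matrix.SpecialLinearGroup.coe_inv, Matrix.adjugate_fin_two,
    Matrix.toLin_finTwoProd_apply]
  simp [sub_eq_add_neg]

theorem coeFn_positionUnitary (M : Matrix.SpecialLinearGroup (Fin 2) ℝ) (Φ : TwoMode) :
    positionUnitary M Φ =ᵐ[volume] fun z => Φ (planeInv M z) :=
  Lp.coeFn_compMeasurePreserving Φ (measurePreserving_planeInv M)

theorem inner_positionUnitary (M : Matrix.SpecialLinearGroup (Fin 2) ℝ) (Φ Ψ : TwoMode) :
    inner ℂ (positionUnitary M Φ) (positionUnitary M Ψ) = inner ℂ Φ Ψ :=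
  LinearIsometry.inner_map_map _ Φ Ψ

/-- The Heisenberg action of a two-mode Gaussian unitary on displacements of the first mode. -/
theorem displacementFst_positionUnitary_tmul (M : Matrix.SpecialLinearGroup (Fin 2) ℝ) (α : ℂ)
    (ψ φ : Mode) :
    displacementFst α (positionUnitary M (tmul ψ φ)) = positionUnitary M
      (tmul (displacement ⟨M.1 1 1 * α.re, M.1 0 0 * α.im⟩ ψ)
        (displacement ⟨-M.1 1 0 * α.re, M.1 0 1 * α.im⟩ φ)) := by
  apply Lp.ext
  have hM := measurePreserving_planeInv M
  -- The position shift `(q, 0)` becomes `M⁻¹(q, 0)` and the momentum shift `(p, 0)` becomes `Mᵀ(p,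
  -- 0)`. The phases on the right add up to `det M` times the phase on the left.
  have hdet : M.1 0 0 * M.1 1 1 - M.1 0 1 * M.1 1 0 = 1 := by
    rw [← Matrix.det_fin_two]; exact M.2
  filter_upwards [coeFn_displacementFst α (positionUnitary M (tmul ψ φ)),
    (measurePreserving_sub_fst (Real.sqrt 2 * α.re)).quasiMeasurePreserving.ae
      (coeFn_positionUnitary M (tmul ψ φ)),
    (measurePreserving_sub_fst (Real.sqrt 2 * α.re)).quasiMeasurePreserving.ae
      (hM.quasiMeasurePreserving.ae (coeFn_tmul ψ φ)),
    coeFn_positionUnitary M (tmul (displacement ⟨M.1 1 1 * α.re, M.1 0 0 * α.im⟩ ψ)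
        (displacement ⟨-M.1 1 0 * α.re, M.1 0 1 * α.im⟩ φ)),
    hM.quasiMeasurePreserving.ae (coeFn_tmul
      (displacement ⟨M.1 1 1 * α.re, M.1 0 0 * α.im⟩ ψ)
        (displacement ⟨-M.1 1 0 * α.re, M.1 0 1 * α.im⟩ φ)),
    hM.quasiMeasurePreserving.ae (Measure.quasiMeasurePreserving_fst.ae
      (coeFn_displacement ⟨M.1 1 1 * α.re, M.1 0 0 * α.im⟩ ψ)),
    hM.quasiMeasurePreserving.ae (Measure.quasiMeasurePreserving_snd.ae
      (coeFn_displacement ⟨-M.1 1 0 * α.re, M.1 0 1 * α.im⟩ φ))] with z h1 h2 h3 h4 h5 h6 h7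
  rw [h1, h2, h3, h4, h5, h6, h7]
  simp only [planeInv_apply]
  have e1 : M.1 1 1 * (z.1 - Real.sqrt 2 * α.re) - M.1 0 1 * z.2 =
      M.1 1 1 * z.1 - M.1 0 1 * z.2 - Real.sqrt 2 * (M.1 1 1 * α.re) := by ring
  have e2 : -M.1 1 0 * (z.1 - Real.sqrt 2 * α.re) + M.1 0 0 * z.2 =
      -M.1 1 0 * z.1 + M.1 0 0 * z.2 - Real.sqrt 2 * (-M.1 1 0 * α.re) := by ring
  rw [e1, e2, mul_mul_mul_comm]
  congr 1
  rw [displacementPhase, displacementPhase, displacementPhase, ← Complex.exp_add, ← mul_add]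
  congr 2
  norm_cast
  linear_combination (α.re * α.im - Real.sqrt 2 * α.im * z.1) * hdet

/-! ### Matrix elements of displacements between number states -/

/-- At `n = 0` the truncated index `n - 1` is harmless, since its coefficient vanishes. -/
theorem derivative_hermite (n : ℕ) :
    derivative (hermite n) = (n : Polynomial ℤ) * hermite (n - 1) := by
  induction n with
  | zero => simp
  | succ n ih =>
    cases n with
    | zero => simp
    | succ n =>
      rw [Polynomial.hermite_succ (n + 1), Polynomial.derivative_sub, Polynomial.derivative_mul, ih,
        Polynomial.derivative_mul, Polynomial.derivative_X, Polynomial.derivative_natCast]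
      simp only [Nat.add_sub_cancel, Polynomial.hermite_succ n]
      push_cast
      ring

/-- The Gaussian weight `exp(-x² + √2 α x - α Re α)`. -/
def gaussWeight (α : ℂ) (x : ℝ) : ℂ :=
  Complex.exp (-1 * (x : ℂ) ^ 2 + Real.sqrt 2 * α * x + -(α.re * α))

/-- Completing the square in the real part of the exponent exhibits a shifted real Gaussian, from
which integrability against polynomials follows. -/
theorem norm_gaussWeight (α : ℂ) (x : ℝ) : ‖gaussWeight α x‖ =
    Real.exp (-(α.re ^ 2 / 2)) * Real.exp (-(x - α.re / Real.sqrt 2) ^ 2) := by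
  rw [gaussWeight, Complex.norm_exp, ← Real.exp_add]
  congr 1
  have h2 : Real.sqrt 2 ^ 2 = 2 := Real.sq_sqrt zero_le_two
  have h0 : Real.sqrt 2 ≠ 0 := by positivity
  simp [← Complex.ofReal_pow]
  field_simp
  linear_combination (- α.re ^ 2 + x * α.re * Real.sqrt 2 * 2) * h2

theorem integral_gaussWeight (α : ℂ) :
    ∫ x, gaussWeight α x = Real.sqrt Real.pi * Complex.exp (-(‖α‖ ^ 2 / 2 : ℝ)) := by
  unfold gaussWeight
  rw [integral_cexp_quadratic (by simp)]
  congr 1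
  · rw [neg_neg, div_one, Real.sqrt_eq_rpow, Complex.ofReal_cpow Real.pi_pos.le]
    norm_num
  · congr 1
    have h2 : (Real.sqrt 2 : ℂ) ^ 2 = 2 := by
      rw [← Complex.ofReal_pow, Real.sq_sqrt zero_le_two]; norm_num
    have h3 : ((‖α‖ ^ 2 / 2 : ℝ) : ℂ) = α * conj α / 2 := by
      rw [Complex.mul_conj, Complex.normSq_eq_norm_sq]; push_cast; ring
    rw [h3, Complex.re_eq_add_conj, mul_pow, h2]
    ring

theorem integrable_eval_mul_gaussWeight (α : ℂ) (P : Polynomial ℂ) :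
    Integrable fun x : ℝ => P.eval (x : ℂ) * gaussWeight α x := by
  have hc : Continuous (gaussWeight α) := by unfold gaussWeight; fun_prop
  induction P using Polynomial.induction_on' with
  | add p q hp hq =>
    refine (hp.add hq).congr (Filter.Eventually.of_forall fun x => ?_)
    simp [add_mul]
  | monomial n a =>
    have h := ((integrable_poly_mul_gaussian ((Polynomial.X +
      Polynomial.C (α.re / Real.sqrt 2)) ^ n)).comp_sub_right (α.re / Real.sqrt 2)).const_mul
      (‖a‖ * Real.exp (-(α.re ^ 2 / 2)))
    refine h.mono (by fun_prop) (Filter.Eventually.of_forall fun x => ?_)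
    simp only [Polynomial.eval_monomial, norm_mul, norm_pow, norm_gaussWeight, Complex.norm_real,
      Polynomial.eval_pow, Polynomial.eval_add, Polynomial.eval_X, Polynomial.eval_C,
      sub_add_cancel, Real.norm_eq_abs, Real.abs_exp, abs_norm]
    exact le_of_eq (by ring)

/-- The functional `P ↦ ∫ P(x) exp(-x² + √2 α x - α Re α) dx`. -/
def gaussMoment (α : ℂ) : Polynomial ℂ →ₗ[ℂ] ℂ where
  toFun P := ∫ x : ℝ, P.eval (x : ℂ) * gaussWeight α x
  map_add' P Q := by
    simp only [Polynomial.eval_add, add_mul]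
    exact integral_add (integrable_eval_mul_gaussWeight α P) (integrable_eval_mul_gaussWeight α Q)
  map_smul' c P := by
    simp only [Polynomial.eval_smul, smul_eq_mul, mul_assoc, RingHom.id_apply]
    exact integral_const_mul _ _

/-- Integration by parts: the integrand is the derivative of `P` times the weight. All recursions
for the matrix elements come from this identity. -/
theorem gaussMoment_derivative (α : ℂ) (P : Polynomial ℂ) :
    gaussMoment α (derivative P + P * (Polynomial.C (Real.sqrt 2 * α) - 2 * Polynomial.X)) = 0 := by
  refine integral_eq_zero_of_hasDerivAt_of_integrable (f := fun x : ℝ =>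
    P.eval (x : ℂ) * gaussWeight α x) (fun x => ?_) (integrable_eval_mul_gaussWeight α _)
    (integrable_eval_mul_gaussWeight α P)
  have h1 : HasDerivAt (fun z : ℂ => P.eval z * Complex.exp (-1 * z ^ 2 + Real.sqrt 2 * α * z +
      -(α.re * α))) _ (x : ℂ) :=
    (P.hasDerivAt x).mul (((((hasDerivAt_id (x : ℂ)).pow 2).const_mul (-1)).add
      ((hasDerivAt_id (x : ℂ)).const_mul (Real.sqrt 2 * α))).add_const _).cexp
  refine h1.comp_ofReal.congr_deriv ?_
  simp [gaussWeight]
  ring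

/-- The polynomial `He_n(√2 (x - c))`. -/
def scaledHermite (n : ℕ) (c : ℂ) : Polynomial ℂ :=
  ((hermite n).map (Int.castRingHom ℂ)).comp
    (Polynomial.C (Real.sqrt 2 : ℂ) * (Polynomial.X - Polynomial.C c))

theorem derivative_scaledHermite (n : ℕ) (c : ℂ) : derivative (scaledHermite n c) =
    Polynomial.C (Real.sqrt 2 * n : ℂ) * scaledHermite (n - 1) c := by
  rw [scaledHermite, Polynomial.derivative_comp, Polynomial.derivative_map, derivative_hermite]
  simp [scaledHermite]
  ring

theorem scaledHermite_succ (n : ℕ) (c : ℂ) : scaledHermite (n + 1) c =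
    Polynomial.C (Real.sqrt 2 : ℂ) * (Polynomial.X - Polynomial.C c) * scaledHermite n c -
      Polynomial.C (n : ℂ) * scaledHermite (n - 1) c := by
  rw [scaledHermite, Polynomial.hermite_succ, derivative_hermite]
  simp [scaledHermite]

/-- The matrix element of the displacement between the number states `m` and `n`, up to the
normalization `√π √(m! n!)`. -/
def hermiteMoment (α : ℂ) (m n : ℕ) : ℂ :=
  gaussMoment α (scaledHermite m 0 * scaledHermite n (Real.sqrt 2 * α.re))

theorem ofReal_sqrt_two_sq : (Real.sqrt 2 : ℂ) ^ 2 = 2 := by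
  rw [← Complex.ofReal_pow, Real.sq_sqrt zero_le_two]; norm_num

theorem C_sqrt_two_sq : (Polynomial.C (Real.sqrt 2 : ℂ)) ^ 2 = 2 := by
  rw [← map_pow, ofReal_sqrt_two_sq]; rfl

/-- The ladder relation `D̂(α) â† = (â† - α*) D̂(α)` between `⟨m|` and `|n⟩`, freed of
normalization. -/
theorem hermiteMoment_succ_right (α : ℂ) (m n : ℕ) : hermiteMoment α m (n + 1) =
    -conj α * hermiteMoment α m n + m * hermiteMoment α (m - 1) n := by
  have h := gaussMoment_derivative α (scaledHermite m 0 * scaledHermite n (Real.sqrt 2 * α.re))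
  -- The two sides of the recursion differ by `√2/2` times an integrand that `gaussMoment`
  -- annihilates.
  have key : scaledHermite m 0 * scaledHermite (n + 1) (Real.sqrt 2 * α.re) =
      (-conj α) • (scaledHermite m 0 * scaledHermite n (Real.sqrt 2 * α.re)) +
      (m : ℂ) • (scaledHermite (m - 1) 0 * scaledHermite n (Real.sqrt 2 * α.re)) -
      (Real.sqrt 2 / 2 : ℂ) • (derivative (scaledHermite m 0 * scaledHermite n (Real.sqrt 2 * α.re))
        + scaledHermite m 0 * scaledHermite n (Real.sqrt 2 * α.re) *
          (Polynomial.C (Real.sqrt 2 * α) - 2 * Polynomial.X)) := by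
    rw [Polynomial.derivative_mul, derivative_scaledHermite, derivative_scaledHermite,
      scaledHermite_succ]
    have hs := C_sqrt_two_sq
    have hα : Polynomial.C α + Polynomial.C (conj α) = 2 * Polynomial.C (α.re : ℂ) := by
      rw [← map_add, Complex.add_conj, Complex.ofReal_mul, map_mul]; rfl
    have hh : Polynomial.C (2⁻¹ : ℂ) * 2 = 1 := by
      rw [show (2 : Polynomial ℂ) = Polynomial.C 2 from rfl, ← map_mul]; simp
    simp only [Polynomial.smul_eq_C_mul, map_neg, map_mul, div_eq_mul_inv]
    generalize Polynomial.C (Real.sqrt 2 : ℂ) = s at *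
    generalize scaledHermite m 0 = A, scaledHermite (m - 1) 0 = A',
      scaledHermite n (Real.sqrt 2 * α.re) = B, scaledHermite (n - 1) (Real.sqrt 2 * α.re) = B' at *
    generalize Polynomial.C (m : ℂ) = cm, Polynomial.C (n : ℂ) = cn, Polynomial.C (2⁻¹ : ℂ) = d,
      Polynomial.C α = a, Polynomial.C (conj α) = b, Polynomial.C (α.re : ℂ) = r at *
    linear_combination (-r * A * B + d * (cm * A' * B + A * cn * B' + A * B * a)) * hs +
      (cm * A' * B + A * cn * B' + A * B * a - s * Polynomial.X * A * B) * hh + A * B * hα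
  rw [hermiteMoment, key, map_sub, map_add, map_smul, map_smul, map_smul, h]
  simp [hermiteMoment]

/-- Reflects `â D̂(α)|0⟩ = α D̂(α)|0⟩`. -/
theorem hermiteMoment_succ_zero (α : ℂ) (m : ℕ) :
    hermiteMoment α (m + 1) 0 = α * hermiteMoment α m 0 := by
  have h0 : scaledHermite 0 (Real.sqrt 2 * α.re) = 1 := by simp [scaledHermite]
  have h := gaussMoment_derivative α (scaledHermite m 0)
  have key : scaledHermite (m + 1) 0 = α • scaledHermite m 0 -
      (Real.sqrt 2 / 2 : ℂ) • (derivative (scaledHermite m 0) + scaledHermite m 0 *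
          (Polynomial.C (Real.sqrt 2 * α) - 2 * Polynomial.X)) := by
    rw [derivative_scaledHermite, scaledHermite_succ]
    have hs := C_sqrt_two_sq
    have hh : Polynomial.C (2⁻¹ : ℂ) * 2 = 1 := by
      rw [show (2 : Polynomial ℂ) = Polynomial.C 2 from rfl, ← map_mul]; simp
    simp only [Polynomial.smul_eq_C_mul, map_mul, div_eq_mul_inv, map_zero]
    generalize Polynomial.C (Real.sqrt 2 : ℂ) = s at *
    generalize scaledHermite m 0 = A, scaledHermite (m - 1) 0 = A', Polynomial.C (m : ℂ) = cm,
      Polynomial.C (2⁻¹ : ℂ) = d, Polynomial.C α = a at *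
    linear_combination d * (cm * A' + A * a) * hs + (cm * A' + A * a - s * Polynomial.X * A) * hh
  rw [hermiteMoment, hermiteMoment, h0, mul_one, mul_one, key, map_sub, map_smul, map_smul, h]
  simp

theorem hermiteMoment_zero_zero (α : ℂ) :
    hermiteMoment α 0 0 = Real.sqrt Real.pi * Complex.exp (-(‖α‖ ^ 2 / 2 : ℝ)) := by
  rw [← integral_gaussWeight]
  simp [hermiteMoment, scaledHermite, gaussMoment]

/-- Solves the two recursions. For `k > m` the truncated exponent `m - k` does not matter, as
`m.choose k = 0`. -/
theorem hermiteMoment_eq (α : ℂ) (m n : ℕ) : hermiteMoment α m n = hermiteMoment α 0 0 *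
    ∑ k ∈ Finset.range (n + 1), (k.factorial * m.choose k * n.choose k : ℂ) *
      (α ^ (m - k) * (-conj α) ^ (n - k)) := by
  induction n generalizing m with
  | zero =>
    induction m with
    | zero => simp
    | succ m ih => rw [hermiteMoment_succ_zero, ih]; simp; ring
  | succ n ih =>
    rw [hermiteMoment_succ_right, ih, ih, mul_left_comm, mul_left_comm (m : ℂ), ← mul_add]
    congr 1
    -- This absorption identity shifts the second term of the recursion by one in `k`, after which
    -- Pascal's rule in `n` combines the two sums.
    have h1 : ∀ k : ℕ, (m : ℂ) * (k.factorial * (m - 1).choose k) =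
        (k + 1).factorial * m.choose (k + 1) := fun k => by
      cases m with
      | zero => simp
      | succ m =>
        have := Nat.add_one_mul_choose_eq m k
        rw [Nat.factorial_succ]
        simp only [Nat.add_sub_cancel]
        have h' : ((m + 1 : ℕ) : ℂ) * m.choose k = (m + 1).choose (k + 1) * (k + 1 : ℕ) := by
          exact_mod_cast this
        push_cast at h' ⊢
        linear_combination (k.factorial : ℂ) * h'
    have h2 : -conj α * ∑ k ∈ Finset.range (n + 1), (k.factorial * m.choose k * n.choose k : ℂ) *
        (α ^ (m - k) * (-conj α) ^ (n - k)) = ∑ k ∈ Finset.range (n + 1 + 1),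
        (k.factorial * m.choose k * n.choose k : ℂ) *
          (α ^ (m - k) * (-conj α) ^ (n + 1 - k)) := by
      rw [Finset.sum_range_succ _ (n + 1), Nat.choose_succ_self, Finset.mul_sum]
      simp only [Nat.cast_zero, mul_zero, zero_mul, add_zero]
      refine Finset.sum_congr rfl fun k hk => ?_
      rw [Nat.succ_sub (Nat.lt_succ_iff.1 (Finset.mem_range.1 hk)), pow_succ]
      ring
    rw [h2, Finset.sum_range_succ' _ (n + 1), Finset.sum_range_succ' _ (n + 1), Finset.mul_sum,
      add_right_comm, ← Finset.sum_add_distrib]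
    congr 1
    · refine Finset.sum_congr rfl fun k _ => ?_
      rw [Nat.choose_succ_succ n k, Nat.add_sub_add_right, Nat.sub_sub, add_comm 1 k]
      push_cast
      linear_combination (n.choose k * (α ^ (m - (k + 1)) * (-conj α) ^ (n - k))) * h1 k
    · simp

theorem inner_fock_displacement_fock (α : ℂ) (m n : ℕ) :
    inner ℂ (fock m) (displacement α (fock n)) = hermiteMoment α m n *
      (Real.sqrt Real.pi * Real.sqrt m.factorial * Real.sqrt n.factorial : ℝ)⁻¹ := by
  rw [mul_comm, L2.inner_def, hermiteMoment, gaussMoment]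
  change _ = _ * ∫ x : ℝ, _
  rw [← integral_const_mul]
  apply integral_congr_ae
  filter_upwards [coeFn_fock m, coeFn_displacement α (fock n),
    ae_sub (coeFn_fock n) (Real.sqrt 2 * α.re)] with x h1 h2 h3
  rw [RCLike.inner_apply, h1, h2, h3]
  have he : displacementPhase α x * (Real.exp (-x ^ 2 / 2) *
      Real.exp (-(x - Real.sqrt 2 * α.re) ^ 2 / 2) : ℝ) = gaussWeight α x := by
    rw [← Real.exp_add, Complex.ofReal_exp, displacementPhase, gaussWeight, ← Complex.exp_add]
    congr 1
    have h3 := ofReal_sqrt_two_sq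
    conv_rhs => rw [← Complex.re_add_im α]
    push_cast
    simp only [Complex.add_re, Complex.ofReal_re, Complex.mul_re, Complex.I_re, mul_zero,
      Complex.ofReal_im, Complex.I_im, mul_one, sub_self, add_zero]
    linear_combination (-(α.re : ℂ) ^ 2 / 2) * h3
  have hH : ∀ (k : ℕ) (c : ℝ), ((Polynomial.aeval (Real.sqrt 2 * (x - c)) (hermite k) : ℝ) : ℂ) =
      (scaledHermite k c).eval (x : ℂ) := fun k c => by
    rw [scaledHermite, Polynomial.eval_comp, ← Polynomial.eval₂_eq_eval_map,
      ← Complex.coe_algebraMap, ← Polynomial.aeval_algebraMap_apply]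
    simp [Polynomial.aeval_def]
  have hH0 := hH m 0
  rw [sub_zero, Complex.ofReal_zero] at hH0
  have hπ : (Real.sqrt (Real.sqrt Real.pi) : ℂ) ^ 2 = Real.sqrt Real.pi := by
    rw [← Complex.ofReal_pow, Real.sq_sqrt (Real.sqrt_nonneg _)]
  rw [conj_fockFun, ← he, Polynomial.eval_mul, ← hH0]
  have hHn := hH n (Real.sqrt 2 * α.re)
  rw [Complex.ofReal_mul] at hHn
  rw [← hHn, fockFun, fockFun]
  push_cast
  rw [← hπ]
  simp only [mul_inv]
  ring

/-- The diagonal matrix elements are Laguerre polynomials times a Gaussian. -/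
theorem inner_fock_displacement_fock_self (α : ℂ) (n : ℕ) :
    inner ℂ (fock n) (displacement α (fock n)) = Complex.exp (-(‖α‖ ^ 2 / 2 : ℝ)) *
      ∑ p ∈ Finset.HasAntidiagonal.antidiagonal n, (n.choose p.1 : ℂ) * (-(‖α‖ ^ 2 : ℝ)) ^ p.1 /
        p.1.factorial := by
  have hn : ((Real.sqrt n.factorial : ℝ) : ℂ) ^ 2 = n.factorial := by
    rw [← Complex.ofReal_pow, Real.sq_sqrt (Nat.cast_nonneg _), Complex.ofReal_natCast]
  have hn0 : (n.factorial : ℂ) ≠ 0 := Nat.cast_ne_zero.2 n.factorial_ne_zero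
  have hπ : (Real.sqrt Real.pi : ℂ) ≠ 0 := by
    rw [Complex.ofReal_ne_zero]; have := Real.pi_pos; positivity
  rw [inner_fock_displacement_fock, hermiteMoment_eq, hermiteMoment_zero_zero]
  have h1 : ∀ a b : ℂ, ((Real.sqrt Real.pi * a) * b) *
      (Real.sqrt Real.pi * Real.sqrt n.factorial * Real.sqrt n.factorial : ℝ)⁻¹ =
      a * (b * (n.factorial : ℂ)⁻¹) := fun a b => by
    rw [← hn]; push_cast; field_simp
  rw [h1, Finset.sum_mul]
  congr 1
  -- After the swap `p.1 = n - k`, the common exponent of `α` and `-α*`.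
  rw [← Finset.Nat.sum_antidiagonal_swap, Finset.Nat.sum_antidiagonal_eq_sum_range_succ_mk]
  refine Finset.sum_congr rfl fun k hk => ?_
  have hk' := Nat.lt_succ_iff.1 (Finset.mem_range.1 hk)
  simp only [Prod.fst_swap]
  rw [Nat.choose_symm hk', ← mul_pow]
  have h2 : α * -conj α = -((‖α‖ ^ 2 : ℝ) : ℂ) := by
    rw [mul_neg, Complex.mul_conj, Complex.normSq_eq_norm_sq]
  have h3 : (n.choose k : ℂ) * k.factorial * (n - k).factorial = n.factorial := by
    exact_mod_cast Nat.choose_mul_factorial_mul_factorial hk'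
  have h4 : ((n - k).factorial : ℂ) ≠ 0 := Nat.cast_ne_zero.2 (Nat.factorial_ne_zero _)
  rw [h2]
  generalize (-((‖α‖ ^ 2 : ℝ) : ℂ)) ^ (n - k) = y
  field_simp
  linear_combination (n.choose k : ℂ) * y * h3

/-- The diagonal matrix element at `α = 0`, where only the constant Laguerre term survives. -/
theorem norm_fock (n : ℕ) : ‖fock n‖ = 1 := by
  have h := inner_fock_displacement_fock_self 0 n
  rw [displacement_zero, inner_self_eq_norm_sq_to_K,
    Finset.Nat.sum_antidiagonal_eq_sum_range_succ_mk, Finset.sum_range_succ'] at h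
  have h2 : ‖fock n‖ ^ 2 = 1 := by
    have : ((‖fock n‖ : ℂ)) ^ 2 = 1 := h.trans (by simp)
    exact_mod_cast this
  exact (pow_eq_one_iff_of_nonneg (norm_nonneg _) two_ne_zero).1 h2

/-! ### Thermal states -/

/-- The number distribution of the thermal state. -/
def thermalWeight (nbar : ℝ) (n : ℕ) : ℝ := nbar ^ n / (nbar + 1) ^ (n + 1)

theorem thermalWeight_nonneg {nbar : ℝ} (hn : 0 ≤ nbar) (n : ℕ) : 0 ≤ thermalWeight nbar n := by
  unfold thermalWeight; positivity

theorem hasSum_of_eq {ι E : Type*} [AddCommMonoid E] [TopologicalSpace E] {f g : ι → E} {a b : E}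
    (h : HasSum f a) (hab : b = a) (hfg : ∀ i, g i = f i) : HasSum g b := by
  rw [hab, funext hfg]; exact h

/-- Binomial moments of the geometric distribution, by the negative binomial series with ratio `n̄ /
(n̄ + 1)`. -/
theorem hasSum_choose_mul_thermalWeight {nbar : ℝ} (hn : 0 ≤ nbar) (j : ℕ) :
    HasSum (fun l => ((j + l).choose j : ℝ) * thermalWeight nbar (j + l)) (nbar ^ j) := by
  have hr : ‖nbar / (nbar + 1)‖ < 1 := by
    rw [Real.norm_of_nonneg (by positivity), div_lt_one (by positivity)]; linarith
  have h := (hasSum_choose_mul_geometric_of_norm_lt_one j hr).mul_left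
    (nbar ^ j / (nbar + 1) ^ (j + 1))
  have h0 : nbar + 1 ≠ 0 := by positivity
  refine hasSum_of_eq h ?_ fun l => ?_
  · have : 1 - nbar / (nbar + 1) = (nbar + 1)⁻¹ := by field_simp; ring
    rw [this, inv_pow]
    field_simp
  · rw [thermalWeight, add_comm l j, div_pow, pow_add nbar, add_right_comm j l 1,
      pow_add (nbar + 1)]
    field_simp

theorem hasSum_thermalWeight {nbar : ℝ} (hn : 0 ≤ nbar) : HasSum (thermalWeight nbar) 1 := by
  simpa using hasSum_choose_mul_thermalWeight hn 0

/-- Write `n = j + l`. Summing over `l` first leaves `(n̄ t)ʲ / j!`; the same computation with `‖t‖`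
gives the absolute convergence that permits regrouping. -/
theorem hasSum_thermalWeight_mul_laguerre {nbar : ℝ} (hn : 0 ≤ nbar) (t : ℂ) :
    HasSum (fun n => (thermalWeight nbar n : ℂ) * ∑ p ∈ Finset.HasAntidiagonal.antidiagonal n,
      (n.choose p.1 : ℂ) * t ^ p.1 / p.1.factorial) (Complex.exp (nbar * t)) := by
  set F : ℕ × ℕ → ℂ := fun p =>
    (((p.1 + p.2).choose p.1 : ℝ) * thermalWeight nbar (p.1 + p.2) : ℝ) *
    (t ^ p.1 / p.1.factorial) with hF
  have hfib : ∀ j, HasSum (fun l => F (j, l)) ((nbar * t) ^ j / j.factorial) := fun j => by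
    have := ((Complex.hasSum_ofReal.2 (hasSum_choose_mul_thermalWeight hn j)).mul_right
      (t ^ j / j.factorial : ℂ))
    refine hasSum_of_eq this ?_ fun l => rfl
    push_cast
    ring
  have hsum : Summable F := by
    refine Summable.of_norm ?_
    have hfib' : ∀ j, HasSum (fun l => ‖F (j, l)‖) ((nbar * ‖t‖) ^ j / j.factorial) := fun j => by
      have := (hasSum_choose_mul_thermalWeight hn j).mul_right (‖t‖ ^ j / j.factorial)
      refine hasSum_of_eq this (by ring) fun l => ?_
      · simp only [hF, norm_mul, norm_div, norm_pow, Complex.norm_natCast, Complex.norm_real]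
        rw [Real.norm_of_nonneg (thermalWeight_nonneg hn _), Real.norm_natCast]
    refine (summable_prod_of_nonneg fun _ => norm_nonneg _).2 ⟨fun j => (hfib' j).summable, ?_⟩
    exact (Real.summable_pow_div_factorial (nbar * ‖t‖)).congr fun j => (hfib' j).tsum_eq.symm
  have h1 : HasSum F (Complex.exp (nbar * t)) := by
    have h2 := hsum.hasSum.prod_fiberwise hfib
    rw [Complex.exp_eq_exp_ℂ, (NormedSpace.expSeries_div_hasSum_exp (nbar * t : ℂ)).unique h2]
    exact hsum.hasSum
  refine ((Finset.HasAntidiagonal.sigmaAntidiagonalEquivProd (A := ℕ)).hasSum_iff.2 h1).sigma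
    fun n => ?_
  convert hasSum_fintype _ using 1
  rw [Finset.mul_sum]
  conv_lhs => rw [← Finset.sum_coe_sort]
  refine Finset.sum_congr rfl fun p _ => ?_
  have hp := Finset.HasAntidiagonal.mem_antidiagonal.1 p.2
  simp only [hF, Function.comp_apply, Finset.HasAntidiagonal.sigmaAntidiagonalEquivProd_apply, hp]
  push_cast
  ring

/-- The expansion vectors of the thermal state. -/
def thermalVec (nbar : ℝ) (n : ℕ) : Mode := (Real.sqrt (thermalWeight nbar n) : ℂ) • fock n

theorem isNuclearSum_thermalState {nbar : ℝ} (hn : 0 ≤ nbar) :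
    IsNuclearSum (thermalVec nbar) (thermalVec nbar) (thermalState nbar) := by
  have hs : Summable fun n => ‖thermalVec nbar n‖ ^ 2 := by
    refine (hasSum_thermalWeight hn).summable.congr fun n => ?_
    rw [thermalVec, norm_smul, norm_fock, mul_one, Complex.norm_real,
      Real.norm_of_nonneg (Real.sqrt_nonneg _), Real.sq_sqrt (thermalWeight_nonneg hn n)]
  refine ⟨hs, hs, ?_⟩
  convert (summable_rankOne hs hs).hasSum using 1
  refine tsum_congr fun n => ?_
  have h : ((Real.sqrt (thermalWeight nbar n) : ℂ)) * Real.sqrt (thermalWeight nbar n) =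
      (thermalWeight nbar n : ℂ) := by
    rw [← Complex.ofReal_mul, Real.mul_self_sqrt (thermalWeight_nonneg hn n)]
  change (thermalWeight nbar n : ℂ) • _ = _
  ext1 x
  rw [thermalVec, ← h]
  rw [InnerProductSpace.rankOne_apply, inner_smul_left, Complex.conj_ofReal,
    smul_apply, InnerProductSpace.rankOne_apply, smul_smul, smul_smul]
  congr 1
  ring

/-- The characteristic function of the thermal state. -/
theorem hasSum_inner_thermalVec {nbar : ℝ} (hn : 0 ≤ nbar) (α : ℂ) :
    HasSum (fun n => inner ℂ (thermalVec nbar n) (displacement α (thermalVec nbar n)))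
      (Complex.exp (-((nbar + 1 / 2) * ‖α‖ ^ 2 : ℝ))) := by
  have h := (hasSum_thermalWeight_mul_laguerre hn (-(‖α‖ ^ 2 : ℝ))).mul_left
    (Complex.exp (-(‖α‖ ^ 2 / 2 : ℝ)))
  refine hasSum_of_eq h ?_ fun n => ?_
  · rw [← Complex.exp_add]
    congr 1
    push_cast
    ring
  · have h : ((Real.sqrt (thermalWeight nbar n) : ℂ)) * Real.sqrt (thermalWeight nbar n) =
        (thermalWeight nbar n : ℂ) := by
      rw [← Complex.ofReal_mul, Real.mul_self_sqrt (thermalWeight_nonneg hn n)]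
    rw [thermalVec, map_smul, inner_smul_left, inner_smul_right, Complex.conj_ofReal, ← mul_assoc,
      h, inner_fock_displacement_fock_self]
    ring

/-- Because `0 ^ 0 = 1`, the `n = 0` term survives; the amplifier's ancilla is thus the thermal
state with `n̄ = 0`. -/
theorem thermalState_zero : thermalState 0 = vacuumState := by
  rw [thermalState, tsum_eq_single 0]
  · simp [vacuumState]
  · intro n hn
    simp [hn]

/-! ### Totality of the coherent states -/

open scoped FourierTransform SchwartzMap ContDiff in
-- A test function `g` is the Fourier transform of a Schwartz function `φ`, so `∫ F g = ∫ 𝓕F φ = 0`.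
theorem ae_eq_zero_of_fourier_eq_zero {F : ℝ → ℂ} (hF : Integrable F) (h : ∀ ξ : ℝ, 𝓕 F ξ = 0) :
    ∀ᵐ x : ℝ, F x = 0 := by
  refine ae_eq_zero_of_integral_contDiff_smul_eq_zero hF.locallyIntegrable fun g hg hc => ?_
  have hc' : HasCompactSupport fun x => (g x : ℂ) := hc.comp_left Complex.ofReal_zero
  have hg' : ContDiff ℝ ∞ fun x => (g x : ℂ) := Complex.ofRealCLM.contDiff.comp hg
  set G : 𝓢(ℝ, ℂ) := hc'.toSchwartzMap hg' with hG
  set φ : 𝓢(ℝ, ℂ) := 𝓕⁻ G with hφ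
  have key : ∫ ξ : ℝ, 𝓕 F ξ • φ ξ = ∫ x : ℝ, F x • 𝓕 (φ : ℝ → ℂ) x := by
    simpa using! (VectorFourier.integral_fourierIntegral_smul_eq_flip (L := innerₗ ℝ)
      Real.continuous_fourierChar continuous_inner hF φ.integrable)
  have h2 : 𝓕 (φ : ℝ → ℂ) = G := by
    rw [← SchwartzMap.fourier_coe, hφ, FourierTransform.fourier_fourierInv_eq]
  rw [h2] at key
  simp only [h, zero_smul, integral_zero] at key
  rw [key]
  refine integral_congr_ae (Filter.Eventually.of_forall fun x => ?_)
  change g x • F x = F x • (g x : ℂ)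
  rw [Complex.real_smul, smul_eq_mul, mul_comm]

theorem inner_complex_eq (a b : ℂ) : inner ℂ a b = b * conj a := RCLike.inner_apply a b

/-- Purely imaginary `α` suffice: those overlaps are the Fourier transform of `f` times the nowhere
vanishing vacuum wave function. -/
theorem eq_zero_of_forall_inner_coherent {f : Mode}
    (h : ∀ α, inner ℂ (displacement α (fock 0)) f = 0) : f = 0 := by
  have hInt : Integrable fun x => f x * fockFun 0 x := by
    refine (L2.integrable_inner (𝕜 := ℂ) (fock 0) f).congr ?_
    filter_upwards [coeFn_fock 0] with x hx
    rw [hx, RCLike.inner_apply, conj_fockFun]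
  have h0 := ae_eq_zero_of_fourier_eq_zero hInt fun ξ => by
    -- The imaginary part is chosen so that the phase frequency `√2 Im α` equals `2πξ`.
    rw [← h ⟨0, Real.sqrt 2 * Real.pi * ξ⟩, L2.inner_def, Real.fourier_eq']
    refine integral_congr_ae ?_
    filter_upwards [coeFn_displacement ⟨0, Real.sqrt 2 * Real.pi * ξ⟩ (fock 0), coeFn_fock 0]
      with x h1 h2
    rw [h1, mul_zero, sub_zero, h2, inner_complex_eq, map_mul, conj_fockFun, displacementPhase,
      ← Complex.exp_conj, smul_eq_mul]
    have : conj (Complex.I * ((Real.sqrt 2 * (Real.sqrt 2 * Real.pi * ξ) * x -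
        0 * (Real.sqrt 2 * Real.pi * ξ) : ℝ) : ℂ)) =
        ((-2 * Real.pi * inner ℝ x ξ : ℝ) : ℂ) * Complex.I := by
      have h2 := ofReal_sqrt_two_sq
      have hi : inner ℝ x ξ = ξ * x := by simp
      rw [map_mul, Complex.conj_I, Complex.conj_ofReal, hi]
      push_cast
      linear_combination (-Complex.I * Real.pi * ξ * x) * h2
    rw [this]
    ring
  apply Lp.ext
  filter_upwards [h0, Lp.coeFn_zero ℂ 2 (volume : Measure ℝ)] with z hz hz'
  rw [hz']
  simpa [fockFun_zero_ne_zero] using hz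

theorem span_coherent_dense :
    (Submodule.span ℂ (Set.range fun α => displacement α (fock 0))).topologicalClosure = ⊤ := by
  rw [Submodule.topologicalClosure_eq_top_iff, Submodule.eq_bot_iff]
  intro f hf
  rw [Submodule.mem_orthogonal] at hf
  exact eq_zero_of_forall_inner_coherent fun α => hf _ (Submodule.subset_span ⟨α, rfl⟩)

theorem clm_ext_coherent {S T : Mode →L[ℂ] Mode}
    (h : ∀ α β, inner ℂ (displacement β (fock 0)) (S (displacement α (fock 0))) =
      inner ℂ (displacement β (fock 0)) (T (displacement α (fock 0)))) : S = T := by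
  refine ContinuousLinearMap.ext_on (Submodule.dense_iff_topologicalClosure_eq_top.2
    span_coherent_dense) ?_
  rintro _ ⟨α, rfl⟩
  rw [← sub_eq_zero]
  refine eq_zero_of_forall_inner_coherent fun β => ?_
  rw [inner_sub_right, h, sub_self]

/-! ### Strong continuity of displacements -/

theorem inner_vacuum_displacement (α : ℂ) :
    inner ℂ (fock 0) (displacement α (fock 0)) = Complex.exp (-(‖α‖ ^ 2 / 2 : ℝ)) := by
  simpa using inner_fock_displacement_fock_self α 0

theorem continuous_weylPhase : Continuous fun p : ℂ × ℂ => weylPhase p.1 p.2 := by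
  unfold weylPhase; fun_prop

/-- For unit vectors `‖a - b‖² = 2 - 2 Re⟨a, b⟩`, and overlaps of coherent states are explicit. -/
theorem continuous_displacement_vacuum : Continuous fun γ => displacement γ (fock 0) := by
  rw [continuous_iff_continuousAt]
  intro δ
  rw [ContinuousAt, tendsto_iff_norm_sub_tendsto_zero]
  have h1 : ∀ γ, ‖displacement γ (fock 0) - displacement δ (fock 0)‖ =
      Real.sqrt (2 - 2 * (weylPhase (-γ) δ * Complex.exp (-(‖-γ + δ‖ ^ 2 / 2 : ℝ))).re) := by
    intro γ
    rw [← Real.sqrt_sq (norm_nonneg (displacement γ (fock 0) - displacement δ (fock 0))),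
      @norm_sub_sq ℂ, norm_displacement_apply, norm_displacement_apply, norm_fock,
      ← ContinuousLinearMap.adjoint_inner_right, adjoint_displacement, displacement_displacement,
      inner_smul_right, inner_vacuum_displacement]
    congr 1
    simp only [RCLike.re_to_complex]
    ring
  simp only [h1]
  have hw : Continuous fun γ => weylPhase (-γ) δ :=
    continuous_weylPhase.comp (continuous_neg.prodMk continuous_const)
  have h2 : Continuous fun γ : ℂ => Real.sqrt (2 - 2 *
      (weylPhase (-γ) δ * Complex.exp (-(‖-γ + δ‖ ^ 2 / 2 : ℝ))).re) := by fun_prop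
  have := h2.tendsto δ
  simpa [weylPhase_neg_self] using this

/-- The Weyl relation gives continuity on the span of coherent states; isometry makes the
approximation uniform in `γ`. -/
theorem continuous_displacement_apply (u : Mode) : Continuous fun γ => displacement γ u := by
  have hspan : ∀ u ∈ Submodule.span ℂ (Set.range fun α => displacement α (fock 0)),
      Continuous fun γ => displacement γ u := by
    intro u hu
    induction hu using Submodule.span_induction with
    | mem x hx =>
      obtain ⟨β, rfl⟩ := hx
      simp only [displacement_displacement]
      exact (continuous_weylPhase.comp (continuous_id.prodMk continuous_const)).smul
        (continuous_displacement_vacuum.comp (continuous_id.add continuous_const))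
    | zero => simpa using continuous_const
    | add x y _ _ hx hy => simp only [map_add]; exact hx.add hy
    | smul c x _ hx => simp only [map_smul]; exact hx.const_smul c
  refine continuous_of_uniform_approx_of_continuous fun s hs => ?_
  obtain ⟨ε, hε, hεs⟩ := Metric.mem_uniformity_dist.1 hs
  obtain ⟨u', hu', hd⟩ := Metric.mem_closure_iff.1
    ((Submodule.dense_iff_topologicalClosure_eq_top.2 span_coherent_dense) u) ε hε
  refine ⟨fun γ => displacement γ u', hspan u' hu', fun γ => hεs ?_⟩
  rw [dist_eq_norm, ← map_sub, norm_displacement_apply, ← dist_eq_norm]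
  exact hd

/-! ### Recovering matrix elements from the characteristic function -/

theorem continuous_inner_displacement (u w : Mode) :
    Continuous fun ξ => inner ℂ w (displacement ξ u) :=
  continuous_const.inner (continuous_displacement_apply u)

theorem norm_inner_displacement_le (u w : Mode) (ξ : ℂ) :
    ‖inner ℂ w (displacement ξ u)‖ ≤ ‖w‖ * ‖u‖ :=
  (norm_inner_le_norm _ _).trans (by rw [norm_displacement_apply])

/-- The weight `exp(-|ξ|²/2)`. -/
def vacuumWeight (ξ : ℂ) : ℂ := Complex.exp (-(‖ξ‖ ^ 2 / 2 : ℝ))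

theorem integrable_vacuumWeight : Integrable vacuumWeight := by
  have h := GaussianFourier.integrable_cexp_neg_mul_sq_norm_add (V := ℂ) (b := 1 / 2)
    (by norm_num) 0 0
  refine h.congr (Filter.Eventually.of_forall fun ξ => ?_)
  simp only [vacuumWeight]
  congr 1
  push_cast
  ring

theorem integrable_gaussian_mul_of_bounded {f : ℂ → ℂ} (hf : Continuous f) {C : ℝ}
    (hC : ∀ ξ, ‖f ξ‖ ≤ C) : Integrable fun ξ => vacuumWeight ξ * f ξ :=
  integrable_vacuumWeight.mul_bdd hf.aestronglyMeasurable (Filter.Eventually.of_forall hC)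

theorem integrable_conj_mul_translate (u w : Mode) (a : ℝ) :
    Integrable fun x => conj (w x) * u (x - Real.sqrt 2 * a) := by
  refine (L2.integrable_inner (𝕜 := ℂ) w (displacement ⟨a, 0⟩ u)).congr ?_
  filter_upwards [coeFn_displacement ⟨a, 0⟩ u] with x hx
  rw [hx, inner_complex_eq]
  simp [displacementPhase, mul_comm]

/-- Averaging over the momentum shift turns the phase into the integral kernel of the vacuum
projector. -/
theorem integral_vacuumWeight_mul_phase (a x : ℝ) :
    ∫ b : ℝ, vacuumWeight ⟨a, b⟩ * displacementPhase ⟨a, b⟩ x =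
      Real.sqrt 2 * Real.pi * (fockFun 0 x * fockFun 0 (x - Real.sqrt 2 * a)) := by
  have h2 := ofReal_sqrt_two_sq
  have hI := Complex.I_sq
  have h1 : ∀ b : ℝ, vacuumWeight ⟨a, b⟩ * displacementPhase ⟨a, b⟩ x =
      Complex.exp (-(1 / 2 : ℂ) * (b : ℂ) ^ 2 + Complex.I * (Real.sqrt 2 * x - a) * b +
        (-(a : ℂ) ^ 2 / 2)) := fun b => by
    rw [vacuumWeight, displacementPhase, ← Complex.exp_add, ← Complex.normSq_eq_norm_sq,
      Complex.normSq_mk]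
    congr 1
    push_cast
    ring
  simp only [h1]
  rw [integral_cexp_quadratic (by norm_num), fockFun_zero, fockFun_zero]
  have h3 : ((Real.pi : ℂ) / -(-(1 / 2))) ^ (1 / 2 : ℂ) = Real.sqrt 2 * Real.sqrt Real.pi := by
    rw [← Complex.ofReal_mul, ← Real.sqrt_mul zero_le_two, Real.sqrt_eq_rpow,
      Complex.ofReal_cpow (by have := Real.pi_pos; positivity)]
    push_cast
    congr 1
    ring
  have h4 : (Real.pi : ℂ) = Real.sqrt Real.pi * Real.sqrt Real.pi := by
    rw [← Complex.ofReal_mul, Real.mul_self_sqrt Real.pi_pos.le]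
  have h5 : (Real.sqrt Real.pi : ℂ) = Real.sqrt (Real.sqrt Real.pi) ^ 2 := by
    rw [← Complex.ofReal_pow, Real.sq_sqrt (Real.sqrt_nonneg _)]
  have h6 : (Real.sqrt (Real.sqrt Real.pi) : ℂ) ≠ 0 := by
    rw [Complex.ofReal_ne_zero]; have := Real.pi_pos; positivity
  have h7 : Complex.exp (-(a : ℂ) ^ 2 / 2 - (Complex.I * (Real.sqrt 2 * x - a)) ^ 2 /
      (4 * -(1 / 2))) = Complex.exp ((-x ^ 2 / 2 : ℝ)) *
        Complex.exp ((-(x - Real.sqrt 2 * a) ^ 2 / 2 : ℝ)) := by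
    rw [← Complex.exp_add]
    congr 1
    push_cast
    linear_combination ((Real.sqrt 2 * x - a : ℂ) ^ 2 / 2) * hI + ((a : ℂ) ^ 2 / 2 - x ^ 2 / 2) * h2
  rw [h3, h7]
  push_cast
  rw [h4, h5]
  field_simp

theorem integral_inner_displacement_im (u w : Mode) (a : ℝ) :
    ∫ b : ℝ, vacuumWeight ⟨a, b⟩ * inner ℂ w (displacement ⟨a, b⟩ u) =
      Real.sqrt 2 * Real.pi * ∫ x, (conj (w x) * fockFun 0 x) *
        (u (x - Real.sqrt 2 * a) * fockFun 0 (x - Real.sqrt 2 * a)) := by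
  set f : ℝ → ℂ := fun x => conj (w x) * u (x - Real.sqrt 2 * a) with hf
  have hin : ∀ b : ℝ, vacuumWeight ⟨a, b⟩ * inner ℂ w (displacement ⟨a, b⟩ u) =
      ∫ x, vacuumWeight ⟨a, b⟩ * displacementPhase ⟨a, b⟩ x * f x := fun b => by
    rw [L2.inner_def, ← integral_const_mul]
    refine integral_congr_ae ?_
    filter_upwards [coeFn_displacement ⟨a, b⟩ u] with x hx
    rw [hx, inner_complex_eq, hf]
    ring
  have hw : Integrable fun b : ℝ => vacuumWeight ⟨a, b⟩ := by
    have h := (integrable_cexp_quadratic (b := (1 / 2 : ℂ)) (by norm_num) 0 (-(a : ℂ) ^ 2 / 2))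
    refine h.congr (Filter.Eventually.of_forall fun b => ?_)
    simp only [vacuumWeight]
    rw [← Complex.normSq_eq_norm_sq, Complex.normSq_mk]
    congr 1
    push_cast
    ring
  have hprod : Integrable (Function.uncurry fun b x : ℝ =>
      vacuumWeight ⟨a, b⟩ * displacementPhase ⟨a, b⟩ x * f x) (volume.prod volume) := by
    have hc : Continuous fun p : ℝ × ℝ => displacementPhase ⟨a, p.1⟩ p.2 := by
      unfold displacementPhase; fun_prop
    refine ((hw.mul_prod (integrable_conj_mul_translate u w a)).mul_bdd (c := 1)
      hc.aestronglyMeasurable (Filter.Eventually.of_forall fun p =>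
        (norm_displacementPhase _ _).le)).congr (Filter.Eventually.of_forall fun p => ?_)
    simp only [Function.uncurry, hf]
    ring
  simp only [hin]
  rw [integral_integral_swap hprod, ← integral_const_mul]
  refine integral_congr_ae (Filter.Eventually.of_forall fun x => ?_)
  beta_reduce
  rw [integral_mul_const, integral_vacuumWeight_mul_phase, hf]
  ring

theorem integrable_mul_fockFun_zero (u : Mode) : Integrable fun x => u x * fockFun 0 x := by
  refine (L2.integrable_inner (𝕜 := ℂ) (fock 0) u).congr ?_
  filter_upwards [coeFn_fock 0] with x hx
  rw [hx, inner_complex_eq, conj_fockFun]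

theorem integral_mul_fockFun_zero (u : Mode) :
    ∫ x, u x * fockFun 0 x = inner ℂ (fock 0) u := by
  rw [L2.inner_def]
  refine integral_congr_ae ?_
  filter_upwards [coeFn_fock 0] with x hx
  rw [hx, inner_complex_eq, conj_fockFun]

/-- The vacuum projector is the Gaussian average of the displacements. -/
theorem integral_inner_displacement (u w : Mode) :
    ∫ ξ, vacuumWeight ξ * inner ℂ w (displacement ξ u) =
      Real.pi * (inner ℂ (fock 0) u * inner ℂ w (fock 0)) := by
  have hmp := Complex.volume_preserving_equiv_real_prod.symm
  have hInt := integrable_gaussian_mul_of_bounded (continuous_inner_displacement u w)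
    (norm_inner_displacement_le u w)
  set P : ℝ → ℂ := fun x => conj (w x) * fockFun 0 x with hP
  -- Reflecting the second factor makes the remaining integrand the convolution `P ⋆ Q` at `√2 a`.
  -- Its integral is `∫ P · ∫ Q`, and the Jacobian `1/√2` cancels the prefactor `√2`.
  set Q : ℝ → ℂ := fun y => u (-y) * fockFun 0 (-y) with hQ
  have hPc : P = fun x => conj (w x * fockFun 0 x) := by
    ext x; rw [hP, map_mul, conj_fockFun]
  have hPi : Integrable P := by
    rw [hPc]
    exact (Complex.conjCLE : ℂ →L[ℝ] ℂ).integrable_comp (integrable_mul_fockFun_zero w)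
  have hQi : Integrable Q := (integrable_mul_fockFun_zero u).comp_neg
  have hconv := integral_convolution (ContinuousLinearMap.mul ℝ ℂ) (μ := volume) (ν := volume)
    hPi hQi
  have hPv : ∫ x, P x = inner ℂ w (fock 0) := by
    rw [hPc, integral_conj, integral_mul_fockFun_zero, inner_conj_symm]
  have hQv : ∫ x, Q x = inner ℂ (fock 0) u := by
    rw [← integral_mul_fockFun_zero]
    exact integral_neg_eq_self (fun x => u x * fockFun 0 x) volume
  rw [← hmp.integral_comp', Measure.volume_eq_prod, integral_prod]
  · change ∫ a : ℝ, ∫ b : ℝ, vacuumWeight ⟨a, b⟩ * inner ℂ w (displacement ⟨a, b⟩ u) = _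
    simp only [integral_inner_displacement_im]
    rw [integral_const_mul]
    have h1 := Measure.integral_comp_mul_left
      (fun c => (convolution P Q (ContinuousLinearMap.mul ℝ ℂ) volume) c) (Real.sqrt 2)
    have h2 : ∀ a : ℝ, (convolution P Q (ContinuousLinearMap.mul ℝ ℂ) volume) (Real.sqrt 2 * a) =
        ∫ x, (conj (w x) * fockFun 0 x) *
          (u (x - Real.sqrt 2 * a) * fockFun 0 (x - Real.sqrt 2 * a)) := fun a => by
      simp only [convolution, ContinuousLinearMap.mul_apply', hP, hQ, neg_sub]
    simp only [h2] at h1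
    rw [h1, hconv, ContinuousLinearMap.mul_apply', hPv, hQv, abs_of_nonneg (by positivity),
      Complex.real_smul]
    have h3 : (Real.sqrt 2 : ℂ) ≠ 0 := by rw [Complex.ofReal_ne_zero]; positivity
    push_cast
    field_simp
  · exact hmp.integrable_comp_of_integrable hInt

/-! ### Characteristic functions -/

/-- `T` is trace class, with characteristic function `χ(ξ) = Tr[T D̂(ξ)]`. -/
def HasCharFun (T : Mode →L[ℂ] Mode) (χ : ℂ → ℂ) : Prop :=
  ∃ (ι : Type) (_ : Countable ι) (u w : ι → Mode), IsNuclearSum u w T ∧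
    ∀ ξ, HasSum (fun i => inner ℂ (w i) (displacement ξ (u i))) (χ ξ)

theorem IsNuclear.exists_hasCharFun {T : Mode →L[ℂ] Mode} (h : IsNuclear T) :
    ∃ χ, HasCharFun T χ := by
  obtain ⟨ι, hι, u, w, h⟩ := h
  exact ⟨fun ξ => ∑' i, inner ℂ (w i) (displacement ξ (u i)), ι, hι, u, w, h,
    fun ξ => (h.summable_inner _ (norm_displacement_le ξ)).hasSum⟩

theorem hasCharFun_thermalState {nbar : ℝ} (hn : 0 ≤ nbar) :
    HasCharFun (thermalState nbar) fun ξ => Complex.exp (-((nbar + 1 / 2) * ‖ξ‖ ^ 2 : ℝ)) :=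
  ⟨ℕ, inferInstance, _, _, isNuclearSum_thermalState hn, hasSum_inner_thermalVec hn⟩

theorem hasSum_prod_mul {ι κ : Type*} {f : ι → ℂ} {g : κ → ℂ} {a b : ℂ} (hf : HasSum f a)
    (hg : HasSum g b) : HasSum (fun p : ι × κ => f p.1 * g p.2) (a * b) :=
  hf.mul hg (summable_mul_of_summable_norm hf.summable.norm hg.summable.norm)

/-- Characteristic functions under Gaussian dilations `T ↦ Tr₂[U (T ⊗ B) U†]`. -/
theorem HasCharFun.partialTrace_positionUnitary {T B : Mode →L[ℂ] Mode} {χ χ' : ℂ → ℂ}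
    (hT : HasCharFun T χ) (hB : HasCharFun B χ') (M : Matrix.SpecialLinearGroup (Fin 2) ℝ) :
    HasCharFun (partialTrace (positionUnitary M ∘L opTensor T B ∘L (positionUnitary M).adjoint))
      fun ξ => χ ⟨M.1 1 1 * ξ.re, M.1 0 0 * ξ.im⟩ * χ' ⟨-M.1 1 0 * ξ.re, M.1 0 1 * ξ.im⟩ := by
  obtain ⟨ι, _, u, w, h, hχ⟩ := hT
  obtain ⟨κ, _, v, v', h', hχ'⟩ := hB
  set Φ : ι × κ → TwoMode := fun p => positionUnitary M (tmul (u p.1) (v p.2)) with hΦ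
  set Ψ : ι × κ → TwoMode := fun p => positionUnitary M (tmul (w p.1) (v' p.2)) with hΨ
  have hU : IsNuclearSum Φ Ψ (positionUnitary M ∘L opTensor T B ∘L (positionUnitary M).adjoint) :=
    (h.opTensor h').conj (positionUnitary M) (positionUnitary M)
  refine ⟨modeIndex × (ι × κ), inferInstance,
    fun p => (tensorRight (modeBasis p.1)).adjoint (Φ p.2),
    fun p => (tensorRight (modeBasis p.1)).adjoint (Ψ p.2), hU.partialTrace, fun ξ => ?_⟩
  have h1 := hχ ⟨M.1 1 1 * ξ.re, M.1 0 0 * ξ.im⟩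
  have h2 := hχ' ⟨-M.1 1 0 * ξ.re, M.1 0 1 * ξ.im⟩
  have h3 := hasSum_prod_mul h1 h2
  refine hU.hasSum_inner_partialTrace (norm_displacement_le ξ)
    (adjoint_tensorRight_displacementFst ξ) (hasSum_of_eq h3 rfl fun p => ?_)
  rw [hΦ, hΨ, displacementFst_positionUnitary_tmul, inner_positionUnitary, inner_tmul]

theorem HasCharFun.continuous {T : Mode →L[ℂ] Mode} {χ : ℂ → ℂ} (h : HasCharFun T χ) :
    Continuous χ := by
  obtain ⟨ι, _, u, w, h, hχ⟩ := h
  have : χ = fun ξ => ∑' i, inner ℂ (w i) (displacement ξ (u i)) :=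
    funext fun ξ => (hχ ξ).tsum_eq.symm
  rw [this]
  exact continuous_tsum (fun i => continuous_inner_displacement (u i) (w i))
    (summable_mul_of_sq (fun _ => norm_nonneg _) (fun _ => norm_nonneg _) h.right h.left)
    fun i ξ => norm_inner_displacement_le (u i) (w i) ξ

theorem HasCharFun.exists_bound {T : Mode →L[ℂ] Mode} {χ : ℂ → ℂ} (h : HasCharFun T χ) :
    ∃ C, ∀ ξ, ‖χ ξ‖ ≤ C := by
  obtain ⟨ι, _, u, w, h, hχ⟩ := h
  refine ⟨∑' i, ‖w i‖ * ‖u i‖, fun ξ => ?_⟩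
  rw [← (hχ ξ).tsum_eq]
  exact tsum_of_norm_bounded (summable_mul_of_sq (fun _ => norm_nonneg _)
    (fun _ => norm_nonneg _) h.right h.left).hasSum
    fun i => norm_inner_displacement_le (u i) (w i) ξ

/-- The phase in `D̂(α) D̂(ξ) D̂(-β)`. -/
def coherentPhase (α β ξ : ℂ) : ℂ := weylPhase ξ (-β) * weylPhase α (ξ + -β)

theorem continuous_coherentPhase (α β : ℂ) : Continuous (coherentPhase α β) := by
  unfold coherentPhase weylPhase; fun_prop

theorem norm_coherentPhase (α β ξ : ℂ) : ‖coherentPhase α β ξ‖ = 1 := by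
  rw [coherentPhase, norm_mul, norm_weylPhase, norm_weylPhase, one_mul]

theorem inner_displacement_three (α β ξ : ℂ) (u w : Mode) :
    inner ℂ (displacement (-α) w) (displacement ξ (displacement (-β) u)) =
      coherentPhase α β ξ * inner ℂ w (displacement (α + (ξ + -β)) u) := by
  rw [← ContinuousLinearMap.adjoint_inner_right, adjoint_displacement, neg_neg,
    displacement_displacement ξ, map_smul, displacement_displacement, smul_smul, inner_smul_right,
    coherentPhase]

/-- Coherent matrix elements are determined by the characteristic function. -/
theorem HasCharFun.inner_coherent {T : Mode →L[ℂ] Mode} {χ : ℂ → ℂ} (h : HasCharFun T χ)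
    (α β : ℂ) :
    Real.pi * inner ℂ (displacement β (fock 0)) (T (displacement α (fock 0))) =
      ∫ ξ, vacuumWeight ξ * (coherentPhase α β ξ * χ (α + (ξ + -β))) := by
  obtain ⟨ι, _, u, w, h, hχ⟩ := h
  have hs := summable_mul_of_sq (fun _ => norm_nonneg _) (fun _ => norm_nonneg _) h.right h.left
  -- The averaged vacuum projector enters through `⟨β|u⟩⟨w|α⟩ = ⟨0|D̂(-β)u⟩⟨D̂(-α)w|0⟩`.
  set F : ι → ℂ → ℂ := fun i ξ => vacuumWeight ξ *
    inner ℂ (displacement (-α) (w i)) (displacement ξ (displacement (-β) (u i))) with hF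
  have hFi : ∀ i, Integrable (F i) := fun i =>
    integrable_gaussian_mul_of_bounded (continuous_inner_displacement _ _)
      (norm_inner_displacement_le _ _)
  have hFs : Summable fun i => ∫ ξ, ‖F i ξ‖ := by
    refine Summable.of_nonneg_of_le (fun i => integral_nonneg fun ξ => norm_nonneg _) (fun i => ?_)
      (hs.mul_left (∫ ξ, ‖vacuumWeight ξ‖))
    rw [← integral_mul_const]
    refine integral_mono (hFi i).norm (integrable_vacuumWeight.norm.mul_const _) fun ξ => ?_
    simp only [hF, norm_mul]
    gcongr
    refine (norm_inner_displacement_le _ _ ξ).trans_eq ?_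
    rw [norm_displacement_apply, norm_displacement_apply]
  have h1 := hasSum_integral_of_summable_integral_norm hFi hFs
  have h2 : HasSum (fun i => inner ℂ (displacement β (fock 0))
      (rankOne ℂ (u i) (w i) (displacement α (fock 0))))
      (inner ℂ (displacement β (fock 0)) (T (displacement α (fock 0)))) :=
    (h.hasSum.mapL (ContinuousLinearMap.apply ℂ Mode (displacement α (fock 0)))).mapL
      (innerSL ℂ (displacement β (fock 0)))
  have h3 := h2.mul_left (Real.pi : ℂ)
  have h4 : (fun i => ∫ ξ, F i ξ) = fun i => (Real.pi : ℂ) * inner ℂ (displacement β (fock 0))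
      (rankOne ℂ (u i) (w i) (displacement α (fock 0))) := by
    ext i
    rw [hF, integral_inner_displacement, InnerProductSpace.rankOne_apply, inner_smul_right,
      ← adjoint_displacement, ← adjoint_displacement, ContinuousLinearMap.adjoint_inner_left,
      ContinuousLinearMap.adjoint_inner_right, mul_comm (inner ℂ (w i) _)]
  rw [h4] at h1
  rw [h3.unique h1]
  refine integral_congr_ae (Filter.Eventually.of_forall fun ξ => ?_)
  simp only [hF, inner_displacement_three]
  rw [tsum_mul_left, tsum_mul_left, (hχ _).tsum_eq]

/-- Only the coherent matrix elements of `T` enter, so an operator-valued integral may stand for `T`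
without a nuclear expansion of its own. -/
theorem eq_of_hasCharFun {S T : Mode →L[ℂ] Mode} {χ : ℂ → ℂ} (hS : HasCharFun S χ)
    (hT : ∀ α β, Real.pi * inner ℂ (displacement β (fock 0)) (T (displacement α (fock 0))) =
      ∫ ξ, vacuumWeight ξ * (coherentPhase α β ξ * χ (α + (ξ + -β)))) : S = T := by
  refine clm_ext_coherent fun α β => ?_
  have hπ : (Real.pi : ℂ) ≠ 0 := Complex.ofReal_ne_zero.2 Real.pi_ne_zero
  exact mul_left_cancel₀ hπ ((hS.inner_coherent α β).trans (hT α β).symm)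

/-! ### Random displacements -/

/-- The phase `exp(ξ γ* - ξ* γ)`. -/
def displacedPhase (γ ξ : ℂ) : ℂ := weylPhase ξ γ * weylPhase (-γ) (ξ + γ)

/-- Exhibits the phase as a character of `γ`, the form needed for the Gaussian Fourier transform. -/
theorem displacedPhase_eq (γ ξ : ℂ) : displacedPhase γ ξ =
    Complex.exp (2 * Complex.I * ((inner ℝ (⟨ξ.im, -ξ.re⟩ : ℂ) γ : ℝ) : ℂ)) := by
  rw [displacedPhase, weylPhase, weylPhase, ← Complex.exp_add, Complex.inner]
  congr 1
  simp
  ring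

theorem norm_displacedPhase (γ ξ : ℂ) : ‖displacedPhase γ ξ‖ = 1 := by
  rw [displacedPhase, norm_mul, norm_weylPhase, norm_weylPhase, one_mul]

/-- Conjugation acts through `D̂(-γ) D̂(ξ) D̂(γ) = exp(ξ γ* - ξ* γ) D̂(ξ)`. -/
theorem HasCharFun.displace {T : Mode →L[ℂ] Mode} {χ : ℂ → ℂ} (h : HasCharFun T χ) (γ : ℂ) :
    HasCharFun (displacement γ ∘L T ∘L (displacement γ).adjoint)
      fun ξ => displacedPhase γ ξ * χ ξ := by
  obtain ⟨ι, hι, u, w, h, hχ⟩ := h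
  refine ⟨ι, hι, _, _, h.conj (displacement γ) (displacement γ), fun ξ => ?_⟩
  refine hasSum_of_eq ((hχ ξ).mul_left (displacedPhase γ ξ)) rfl fun i => ?_
  rw [← ContinuousLinearMap.adjoint_inner_right, adjoint_displacement,
    displacement_displacement ξ, map_smul, displacement_displacement, smul_smul, inner_smul_right,
    displacedPhase,
    show -γ + (ξ + γ) = ξ by ring]

theorem continuous_rankOne {X H : Type*} [TopologicalSpace X] [NormedAddCommGroup H]
    [InnerProductSpace ℂ H] {f g : X → H} (hf : Continuous f) (hg : Continuous g) :
    Continuous fun x => rankOne ℂ (f x) (g x) :=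
  (ContinuousLinearMap.smulRightL ℂ H H).continuous₂.comp
    (((innerSL ℂ).continuous.comp hg).prodMk hf)

/-- Displacements are only used as strongly continuous, yet this holds in operator norm: the
rank-one terms are norm continuous and their series converges uniformly. It gives the measurability
for the Bochner integral. -/
theorem HasCharFun.continuous_displace {T : Mode →L[ℂ] Mode} {χ : ℂ → ℂ} (h : HasCharFun T χ) :
    Continuous fun γ => displacement γ ∘L T ∘L (displacement γ).adjoint := by
  obtain ⟨ι, hι, u, w, h, hχ⟩ := h
  have h1 : (fun γ => displacement γ ∘L T ∘L (displacement γ).adjoint) = fun γ => ∑' i,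
      rankOne ℂ (displacement γ (u i)) (displacement γ (w i)) :=
    funext fun γ => (h.conj (displacement γ) (displacement γ)).hasSum.tsum_eq.symm
  rw [h1]
  refine continuous_tsum (fun i => ?_) (summable_mul_of_sq (fun _ => norm_nonneg _)
    (fun _ => norm_nonneg _) h.left h.right) fun i γ => ?_
  · exact continuous_rankOne (continuous_displacement_apply (u i))
      (continuous_displacement_apply (w i))
  · rw [InnerProductSpace.norm_rankOne, norm_displacement_apply, norm_displacement_apply]

theorem integrable_exp_neg_norm_sq_div {v : ℝ} (hv : 0 < v) :
    Integrable fun γ : ℂ => Real.exp (-‖γ‖ ^ 2 / v) := by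
  have h := (GaussianFourier.integrable_cexp_neg_mul_sq_norm_add (V := ℂ) (b := (v⁻¹ : ℝ))
    (by simpa using hv) 0 0).norm
  refine h.congr (Filter.Eventually.of_forall fun γ => ?_)
  simp only [zero_mul, add_zero, Complex.norm_exp]
  congr 1
  rw [← Complex.ofReal_neg, ← Complex.ofReal_pow, ← Complex.ofReal_mul, Complex.ofReal_re]
  ring

theorem integral_exp_mul_displacedPhase {v : ℝ} (hv : 0 < v) (ξ : ℂ) :
    ∫ γ : ℂ, (Real.exp (-‖γ‖ ^ 2 / v) : ℂ) * displacedPhase γ ξ =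
      Real.pi * v * Complex.exp (-(v * ‖ξ‖ ^ 2 : ℝ)) := by
  have h := GaussianFourier.integral_cexp_neg_mul_sq_norm_add (V := ℂ) (b := (v⁻¹ : ℝ))
    (by simpa using hv) (2 * Complex.I) ⟨ξ.im, -ξ.re⟩
  have hv' : (v : ℂ) ≠ 0 := Complex.ofReal_ne_zero.2 hv.ne'
  have hn : ‖(⟨ξ.im, -ξ.re⟩ : ℂ)‖ ^ 2 = ‖ξ‖ ^ 2 := by
    rw [← Complex.normSq_eq_norm_sq, ← Complex.normSq_eq_norm_sq, Complex.normSq_mk,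
      Complex.normSq_apply]
    ring
  rw [Complex.finrank_real_complex, ← Complex.ofReal_pow ‖_‖, hn] at h
  have e : ((2 : ℕ) : ℂ) / 2 = 1 := by norm_num
  rw [e, Complex.cpow_one] at h
  convert h using 1
  · refine integral_congr_ae (Filter.Eventually.of_forall fun γ => ?_)
    simp only [displacedPhase_eq]
    rw [Complex.ofReal_exp, ← Complex.exp_add]
    congr 2
    push_cast
    ring
  · congr 1
    · push_cast; field_simp
    · congr 1
      rw [mul_pow, Complex.I_sq]
      push_cast
      field_simp
      ring

theorem inner_smul_integral_apply {A : ℂ → Mode →L[ℂ] Mode} (hA : Integrable A) (c : ℝ)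
    (f g : Mode) : inner ℂ f ((c • ∫ γ, A γ) g) = c * ∫ γ, inner ℂ f (A γ g) := by
  have h := (innerSL ℂ f ∘L ContinuousLinearMap.apply ℂ Mode g).integral_comp_comm hA
  rw [smul_apply, RCLike.real_smul_eq_coe_smul (K := ℂ), inner_smul_right]
  congr 1
  exact h.symm

theorem HasCharFun.integrable_displace {T : Mode →L[ℂ] Mode} {χ : ℂ → ℂ} (h : HasCharFun T χ)
    {v : ℝ} (hv : 0 < v) : Integrable fun γ : ℂ => Real.exp (-‖γ‖ ^ 2 / v) •
      (displacement γ ∘L T ∘L (displacement γ).adjoint) := by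
  refine (integrable_exp_neg_norm_sq_div hv).smul_bdd ‖T‖
    h.continuous_displace.aestronglyMeasurable (Filter.Eventually.of_forall fun γ => ?_)
  refine (ContinuousLinearMap.opNorm_comp_le _ _).trans ?_
  refine (mul_le_mul (norm_displacement_le γ) (ContinuousLinearMap.opNorm_comp_le _ _)
    (norm_nonneg _) zero_le_one).trans ?_
  rw [one_mul, adjoint_displacement]
  exact mul_le_of_le_one_right (norm_nonneg _) (norm_displacement_le _)

theorem integrable_prod_mul_of_bounded {f g : ℂ → ℂ} (hf : Integrable f) (hg : Integrable g)
    {K : ℂ × ℂ → ℂ} (hK : Continuous K) {C : ℝ} (hC : ∀ p, ‖K p‖ ≤ C) :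
    Integrable (fun p : ℂ × ℂ => f p.1 * g p.2 * K p) (volume.prod volume) :=
  (hf.mul_prod hg).mul_bdd hK.aestronglyMeasurable (Filter.Eventually.of_forall hC)

/-- The integrand of the coherent matrix elements of a Gaussian mixture of displacements. -/
def mixtureKernel (v : ℝ) (χ : ℂ → ℂ) (α β γ ξ : ℂ) : ℂ :=
  (Real.exp (-‖γ‖ ^ 2 / v) : ℂ) * (vacuumWeight ξ * (coherentPhase α β ξ *
    (displacedPhase γ (α + (ξ + -β)) * χ (α + (ξ + -β)))))

theorem integrable_mixtureKernel {v : ℝ} (hv : 0 < v) {χ : ℂ → ℂ} (hχ : Continuous χ) {C : ℝ}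
    (hC : ∀ ξ, ‖χ ξ‖ ≤ C) (α β : ℂ) :
    Integrable (Function.uncurry (mixtureKernel v χ α β)) (volume.prod volume) := by
  have a1 := continuous_coherentPhase α β
  have a2 : Continuous fun p : ℂ × ℂ => displacedPhase p.1 (α + (p.2 + -β)) := by
    unfold displacedPhase weylPhase; fun_prop
  have a3 : Continuous fun p : ℂ × ℂ => coherentPhase α β p.2 *
      (displacedPhase p.1 (α + (p.2 + -β)) * χ (α + (p.2 + -β))) := by fun_prop
  refine (integrable_prod_mul_of_bounded ((integrable_exp_neg_norm_sq_div hv).ofReal (𝕜 := ℂ))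
    integrable_vacuumWeight a3 (C := C) fun p => ?_).congr (Filter.Eventually.of_forall fun p => ?_)
  · rw [norm_mul, norm_mul, norm_coherentPhase, norm_displacedPhase, one_mul, one_mul]
    exact hC _
  · exact mul_assoc _ _ _

theorem integral_mixtureKernel_left {v : ℝ} (hv : 0 < v) (χ : ℂ → ℂ) (α β ξ : ℂ) :
    ∫ γ, mixtureKernel v χ α β γ ξ = Real.pi * v * (vacuumWeight ξ * (coherentPhase α β ξ *
      (χ (α + (ξ + -β)) * Complex.exp (-(v * ‖α + (ξ + -β)‖ ^ 2 : ℝ))))) := by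
  have h : ∀ γ, mixtureKernel v χ α β γ ξ =
      vacuumWeight ξ * (coherentPhase α β ξ * χ (α + (ξ + -β))) *
        ((Real.exp (-‖γ‖ ^ 2 / v) : ℂ) * displacedPhase γ (α + (ξ + -β))) := fun γ => by
    rw [mixtureKernel]
    ring
  simp only [h]
  rw [integral_const_mul, integral_exp_mul_displacedPhase hv]
  ring

theorem HasCharFun.inner_exp_smul_displace {T : Mode →L[ℂ] Mode} {χ : ℂ → ℂ}
    (h : HasCharFun T χ) (v : ℝ) (α β γ : ℂ) :
    inner ℂ (displacement β (fock 0)) ((Real.exp (-‖γ‖ ^ 2 / v) •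
      (displacement γ ∘L T ∘L (displacement γ).adjoint)) (displacement α (fock 0))) =
      (Real.pi : ℂ)⁻¹ * ∫ ξ, mixtureKernel v χ α β γ ξ := by
  have hπ : (Real.pi : ℂ) ≠ 0 := Complex.ofReal_ne_zero.2 Real.pi_ne_zero
  have h1 : ∫ ξ, mixtureKernel v χ α β γ ξ = (Real.exp (-‖γ‖ ^ 2 / v) : ℂ) * (Real.pi *
      inner ℂ (displacement β (fock 0)) ((displacement γ ∘L T ∘L (displacement γ).adjoint)
        (displacement α (fock 0)))) := by
    rw [(h.displace γ).inner_coherent α β, ← integral_const_mul]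
    rfl
  rw [h1, smul_apply, RCLike.real_smul_eq_coe_smul (K := ℂ), inner_smul_right, mul_left_comm,
    inv_mul_cancel_left₀ hπ]
  rfl

/-- The mixture multiplies `χ` by `exp(-v|ξ|²)`, seen in coherent matrix elements. Fubini applies
because `χ` is bounded and continuous and both weights are integrable. -/
theorem HasCharFun.inner_randomDisplacement {T : Mode →L[ℂ] Mode} {χ : ℂ → ℂ}
    (h : HasCharFun T χ) {v : ℝ} (hv : 0 ≤ v) (α β : ℂ) :
    Real.pi * inner ℂ (displacement β (fock 0))
        (randomDisplacement v T (displacement α (fock 0))) =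
      ∫ ξ, vacuumWeight ξ * (coherentPhase α β ξ *
        (χ (α + (ξ + -β)) * Complex.exp (-(v * ‖α + (ξ + -β)‖ ^ 2 : ℝ)))) := by
  rcases hv.eq_or_lt with rfl | hv
  · rw [randomDisplacement, if_pos rfl, h.inner_coherent α β]
    simp only [zero_mul, Complex.ofReal_zero, neg_zero, Complex.exp_zero, mul_one]
  have hπ : (Real.pi : ℂ) ≠ 0 := Complex.ofReal_ne_zero.2 Real.pi_ne_zero
  have hv' : (v : ℂ) ≠ 0 := Complex.ofReal_ne_zero.2 hv.ne'
  obtain ⟨C, hC⟩ := h.exists_bound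
  rw [randomDisplacement, if_neg hv.ne', inner_smul_integral_apply (h.integrable_displace hv)]
  simp only [h.inner_exp_smul_displace]
  rw [integral_const_mul, integral_integral_swap (integrable_mixtureKernel hv h.continuous hC α β)]
  simp only [integral_mixtureKernel_left hv]
  rw [integral_const_mul]
  push_cast
  field_simp

/-! ### The channels -/

/-- The beam splitter matrix is orthogonal, so both quadratures scale alike: the system sees `√η ξ`
and the ancilla `√(1-η) ξ`. -/
theorem HasCharFun.lossChannel {T : Mode →L[ℂ] Mode} {χ : ℂ → ℂ} (h : HasCharFun T χ) {η : ℝ}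
    (hη : η ∈ Set.Icc (0 : ℝ) 1) {nbar : ℝ} (hn : 0 ≤ nbar) :
    HasCharFun (lossChannel η hη nbar T) fun ξ => χ (Real.sqrt η * ξ) *
      Complex.exp (-((nbar + 1 / 2) * ((1 - η) * ‖ξ‖ ^ 2) : ℝ)) := by
  have key := h.partialTrace_positionUnitary (hasCharFun_thermalState hn) (beamSplitterMatrix η hη)
  have h1 : ∀ ξ : ℂ, (Real.sqrt η * ξ : ℂ) = ⟨Real.sqrt η * ξ.re, Real.sqrt η * ξ.im⟩ :=
    fun ξ => by apply Complex.ext <;> simp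
  have h2 : ∀ ξ : ℂ, (1 - η) * ‖ξ‖ ^ 2 =
      ‖(⟨-(-Real.sqrt (1 - η)) * ξ.re, Real.sqrt (1 - η) * ξ.im⟩ : ℂ)‖ ^ 2 := fun ξ => by
    rw [← Complex.normSq_eq_norm_sq, ← Complex.normSq_eq_norm_sq, Complex.normSq_apply,
      Complex.normSq_mk]
    linear_combination -(ξ.re * ξ.re + ξ.im * ξ.im) * Real.mul_self_sqrt (sub_nonneg.2 hη.2)
  simp only [h1, h2]
  exact key

/-- The ancilla sees `-√(G-1) ξ*`; the conjugation is invisible because the vacuum characteristic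
function depends only on the modulus. -/
theorem HasCharFun.amplifier {T : Mode →L[ℂ] Mode} {χ : ℂ → ℂ} (h : HasCharFun T χ) {G : ℝ}
    (hG : 1 ≤ G) :
    HasCharFun (amplifier G hG T) fun ξ => χ (Real.sqrt G * ξ) *
      Complex.exp (-((0 + 1 / 2) * ((G - 1) * ‖ξ‖ ^ 2) : ℝ)) := by
  have key := h.partialTrace_positionUnitary (hasCharFun_thermalState le_rfl)
    (twoModeSqueezingMatrix G hG)
  rw [thermalState_zero] at key
  have h1 : ∀ ξ : ℂ, (Real.sqrt G * ξ : ℂ) = ⟨Real.sqrt G * ξ.re, Real.sqrt G * ξ.im⟩ :=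
    fun ξ => by apply Complex.ext <;> simp
  have h2 : ∀ ξ : ℂ, (G - 1) * ‖ξ‖ ^ 2 =
      ‖(⟨-Real.sqrt (G - 1) * ξ.re, Real.sqrt (G - 1) * ξ.im⟩ : ℂ)‖ ^ 2 := fun ξ => by
    rw [← Complex.normSq_eq_norm_sq, ← Complex.normSq_eq_norm_sq, Complex.normSq_apply,
      Complex.normSq_mk]
    linear_combination -(ξ.re * ξ.re + ξ.im * ξ.im) * Real.mul_self_sqrt (sub_nonneg.2 hG)
  simp only [h1, h2]
  exact key

end

end Bosonic

/-! ### Composition of the channels and comparison of variances -/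

theorem lemma1 (η nbar : ℝ) (hη0 : 0 < η) (hη1 : η ≤ 1) (hn : 0 ≤ nbar) :
    (∀ ρ ∈ Bosonic.traceClass,
      Bosonic.lossChannel η ⟨hη0.le, hη1⟩ nbar
          (Bosonic.amplifier (1 / η) (one_le_one_div hη0 hη1) ρ) =
        Bosonic.randomDisplacement (Bosonic.preAmpVariance η nbar) ρ) ∧
    (η < 1 → Bosonic.preAmpVariance η nbar < Bosonic.postAmpVariance η nbar) := by
  refine ⟨fun ρ hρ => ?_, fun hη => ?_⟩
  · obtain ⟨χ, hχ⟩ := (Bosonic.isNuclear_of_mem_traceClass hρ).exists_hasCharFun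
    have hv : 0 ≤ Bosonic.preAmpVariance η nbar :=
      mul_nonneg (sub_nonneg.2 hη1) (by linarith)
    refine Bosonic.eq_of_hasCharFun ((hχ.amplifier (one_le_one_div hη0 hη1)).lossChannel
      ⟨hη0.le, hη1⟩ hn) fun α β => ?_
    rw [hχ.inner_randomDisplacement hv]
    congr 1
    ext ξ
    congr 2
    generalize α + (ξ + -β) = ζ
    have h1 : (Real.sqrt (1 / η) : ℂ) * (Real.sqrt η * ζ) = ζ := by
      rw [← mul_assoc, ← Complex.ofReal_mul, ← Real.sqrt_mul (by positivity), one_div,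
        inv_mul_cancel₀ hη0.ne', Real.sqrt_one, Complex.ofReal_one, one_mul]
    -- The amplifier's exponent is evaluated at `√η ζ`, so its coefficient is `(1/2)(1/η - 1)η =
    -- (1-η)/2`; adding `(n̄ + 1/2)(1-η)` gives the variance.
    rw [h1, mul_assoc, ← Complex.exp_add, norm_mul, Complex.norm_real, Real.norm_eq_abs, mul_pow,
      sq_abs, Real.sq_sqrt hη0.le, Bosonic.preAmpVariance]
    congr 2
    norm_cast
    field_simp
    ring
  · rw [Bosonic.preAmpVariance, Bosonic.postAmpVariance]
    have h1 : 0 < 1 - η := by linarith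
    refine mul_lt_mul_of_pos_right ?_ (by linarith)
    rw [lt_div_iff₀ hη0]
    nlinarith
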